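/- Let $\mathbf k$ be a field, $n\ge 1$, $q\in\mathbf k^\times$ with $q^3\ne1$, $q^4\neq 1$, and let $p_{ij}\in\mathbf k^\times$ ($1\le i,j\le n$) satisfy $p_{nn}=q$; $p_{ii}=q^2$ and $p_{i\,i+1}p_{i+1\,i}=q^{-2}$ for $1\le i<n$; $p_{ij}p_{ji}=1$ for $j>i+1$. Put $X=\{x_1,\dots,x_n\}$, $V=\bigoplus_{i\le n}\mathbf k x_i$, and let $p(u,v)$, for words $u,v$ in $X$, be the product of all $p_{ij}$ with $x_i$ running over the letters of $u$ and $x_j$ over those of $v$. Let $[\,,]$ be the bilinear operation on $\mathbf k\langle X\rangle$ with $[u,v]=uv-p(u,v)vu$ for words $u,v$. Let $G$ be the group generated by the diagonal transformations $g_j:x_i\mapsto p_{ij}x_i$ of $V$, $\chi^i$ its character with $\chi^i(g_j)=p_{ij}$, and $G\langle X\rangle$ the skew group algebra with $x_ig=\chi^i(g)\,gx_i$, a Hopf algebra with $\Delta(x_i)=x_i\otimes1+g_i\otimes x_i$ and $\Delta(g)=g\otimes g$. Let $U_q^+(\mathfrak{so}_{2n+1})$ be the quotient of $G\langle X\rangle$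 by the relations $[x_i,[x_i,x_{i+1}]]=0$ ($1\le i<n$), $[x_i,x_j]=0$ ($j>i+1$), $[[x_i,x_{i+1}],x_{i+1}]=0$ ($1\le i<n-1$) and, if $n\ge2$, $[[[x_{n-1},x_n],x_n],x_n]=0$. Let $u_q^+(\mathfrak{so}_{2n+1})=G\langle X\rangle/\Lambda$, where $\Lambda$ is the biggest Hopf ideal contained in the ideal generated by all $x_ix_j$. In either of these algebras let $A$ be the subalgebra generated by the values $a_i$ of the $x_i$. Let $Sh_\tau(V)$ be the quantum shuffle algebra of the braiding $\tau(u\otimes v)=p(v,u)^{-1}v\otimes u$: the tensor space of $V$, with basis the tensors $(z_1\cdots z_r)=z_1\otimes\cdots\otimes z_r$, $z_i\in X$, with the empty tensor as unit and the product determined by $(xu)(yv)=x\big((u)(yv)\big)+p(y,xu)^{-1}\,y\big((xu)(v)\big)$ for letters $x,y$ and words $u,v$ (so $(w)(x_i)=\sum_{uv=w}p(x_i,v)^{-1}(ux_iv)$ and $(x_i)(w)=\sum_{uv=w}p(u,x_i)^{-1}(ux_iv)$). The shuffle representation of $A$ is the homomorphism of algebras $A\to Sh_\tau(V)$ with $a_i\mapsto(x_i)$.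 For $1\le i\le 2n$ put $\psi(i)=2n-i+1$, and for $n<i\le2n$ put $x_i=x_{\psi(i)}$; accordingly $p_{ij}=p(x_i,x_j)$ for $1\le i,j\le 2n$. For $1\le k\le m\le 2n$ let $u(k,m)=x_kx_{k+1}\cdots x_m$, $u(m,k)=x_mx_{m-1}\cdots x_k$ and $$u[k,m]=\begin{cases}[[\dots[x_k,x_{k+1}],\dots],x_m], & m<\psi(k),\\ [x_k,[x_{k+1},[\dots,x_m]\dots]], & m>\psi(k),\\ -p(u(n+1,m),u(k,n))^{-1}\,[u[n+1,m],u[k,n]], & m=\psi(k).\end{cases}$$ **Proposition.** For each of $U_q^+(\mathfrak{so}_{2n+1})$ and $u_q^+(\mathfrak{so}_{2n+1})$ the shuffle representation of $A$ exists and is unique, and for all $1\le k\le m\le 2n$ the image under it of the value of $u[k,m]$ in $A$ is $$\alpha_k^m\cdot(u(m,k)),\qquad \alpha_k^m=\varepsilon_k^m\,(q^2-1)^{m-k}\prod_{k\le i<j\le m}p_{ij},$$ where $\varepsilon_k^m=1$ if $m\le n$ or $k>n$; $\varepsilon_k^m=q^{-1}$ if $k\le n<m$ and $m\ne\psi(k)$;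 and $\varepsilon_k^m=q^{-3}$ if $m=\psi(k)$. -/

import Mathlib

open scoped TensorProduct

namespace QBorel

section Letters

variable {𝕜 ι : Type*} [Field 𝕜]

/-- `p(u, v)` for words `u`, `v`: the product of all `p x y`, `x` a letter of `u`, `y` of `v`. -/
def pw (p : ι → ι → 𝕜ˣ) (u v : List ι) : 𝕜ˣ :=
  (u.map fun x => (v.map fun y => p x y).prod).prod

/-- The diagonal transformation `g_j : x_i ↦ p_{ij} x_i`. An element `g : ι → 𝕜ˣ` stands for the
diagonal transformation `x_i ↦ g i • x_i`. -/
def gElt (p : ι → ι → 𝕜ˣ) (j : ι) : ι → 𝕜ˣ := fun i => p i j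

/-- The group `G` generated by the diagonal transformations `g_j`. -/
def grp (p : ι → ι → 𝕜ˣ) : Subgroup (ι → 𝕜ˣ) := Subgroup.closure (Set.range (gElt p))

/-- `g_j` as an element of `G`. -/
def gGen (p : ι → ι → 𝕜ˣ) (j : ι) : grp p := ⟨gElt p j, Subgroup.subset_closure ⟨j, rfl⟩⟩

/-- The character `χ^i` of `G`, which has `χ^i(g_j) = p_{ij}`. -/
def chi (p : ι → ι → 𝕜ˣ) (i : ι) : grp p →* 𝕜ˣ where
  toFun g := g.1 i
  map_one' := rfl
  map_mul' _ _ := rfl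

/-- The action of `G` on the free algebra by which `G` and `𝕜⟨X⟩` are multiplied in the skew group
algebra: `g x_i g⁻¹ = χ^i(g)⁻¹ x_i`, that is `g⁻¹ x_i g = χ^i(g) x_i`. -/
noncomputable def actHom (p : ι → ι → 𝕜ˣ) (g : grp p) : FreeAlgebra 𝕜 ι →ₐ[𝕜] FreeAlgebra 𝕜 ι :=
  FreeAlgebra.lift 𝕜 fun i => ((chi p i g)⁻¹ : 𝕜ˣ) • FreeAlgebra.ι 𝕜 i

noncomputable instance instAction (p : ι → ι → 𝕜ˣ) :
    MulSemiringAction (grp p) (FreeAlgebra 𝕜 ι) where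
  smul g x := actHom p g x
  one_smul x := by
    have : actHom p 1 = AlgHom.id 𝕜 _ := by
      ext i; simp [actHom]
    exact congrArg (fun f => f x) this
  mul_smul g h x := by
    have : actHom p (g * h) = (actHom p g).comp (actHom p h) := by
      ext i
      simp only [actHom, Function.comp_apply, FreeAlgebra.lift_ι_apply, AlgHom.comp_apply,
        Units.smul_def, map_smul, map_mul, mul_inv, smul_smul]
      congr 1
      push_cast
      ring
    exact congrArg (fun f => f x) this
  smul_zero g := map_zero (actHom p g)
  smul_add g := map_add (actHom p g)
  smul_one g := map_one (actHom p g)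
  smul_mul g := map_mul (actHom p g)

theorem smul_def (p : ι → ι → 𝕜ˣ) (g : grp p) (x : FreeAlgebra 𝕜 ι) : g • x = actHom p g x := rfl

instance (p : ι → ι → 𝕜ˣ) : SMulCommClass (grp p) 𝕜 (FreeAlgebra 𝕜 ι) where
  smul_comm g c x := map_smul (actHom p g) c x

/-- The skew group algebra `G⟨X⟩` of `G` over the free algebra `𝕜⟨X⟩`. -/
def GX (p : ι → ι → 𝕜ˣ) := SkewMonoidAlgebra (FreeAlgebra 𝕜 ι) (grp p)

noncomputable instance (p : ι → ι → 𝕜ˣ) : Ring (GX p) :=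
  inferInstanceAs (Ring (SkewMonoidAlgebra (FreeAlgebra 𝕜 ι) (grp p)))

noncomputable instance (p : ι → ι → 𝕜ˣ) : Algebra 𝕜 (GX p) :=
  inferInstanceAs (Algebra 𝕜 (SkewMonoidAlgebra (FreeAlgebra 𝕜 ι) (grp p)))

/-- The element `x g` of `G⟨X⟩`, for `x ∈ 𝕜⟨X⟩` and `g ∈ G`. -/
noncomputable def sgl (p : ι → ι → 𝕜ˣ) (g : grp p) (x : FreeAlgebra 𝕜 ι) : GX p :=
  SkewMonoidAlgebra.single g x

theorem sgl_mul_sgl (p : ι → ι → 𝕜ˣ) (g h : grp p) (x y : FreeAlgebra 𝕜 ι) :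
    sgl p g x * sgl p h y = sgl p (g * h) (x * g • y) :=
  SkewMonoidAlgebra.single_mul_single

/-- `g ∈ G` as an element of `G⟨X⟩`. -/
noncomputable def grpOf (p : ι → ι → 𝕜ˣ) : grp p →* GX p where
  toFun g := sgl p g 1
  map_one' := rfl
  map_mul' g h := by rw [sgl_mul_sgl, smul_one, one_mul]

/-- The inclusion of the free algebra `𝕜⟨X⟩` in `G⟨X⟩`. -/
noncomputable def freeOf (p : ι → ι → 𝕜ˣ) : FreeAlgebra 𝕜 ι →ₐ[𝕜] GX p where
  toFun x := sgl p 1 x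
  map_one' := rfl
  map_mul' x y := by rw [sgl_mul_sgl, one_smul, one_mul]
  map_zero' := SkewMonoidAlgebra.single_zero 1
  map_add' x y := SkewMonoidAlgebra.single_add 1 x y
  commutes' _ := rfl

/-- The variable `x_i` as an element of `G⟨X⟩`. -/
noncomputable def xOf (p : ι → ι → 𝕜ˣ) (i : ι) : GX p := freeOf p (FreeAlgebra.ι 𝕜 i)

theorem sgl_eq (p : ι → ι → 𝕜ˣ) (g : grp p) (x : FreeAlgebra 𝕜 ι) :
    sgl p g x = freeOf p x * grpOf p g := by
  change _ = sgl p 1 x * sgl p g 1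
  rw [sgl_mul_sgl, one_smul, one_mul, mul_one]

theorem grpOf_mul_freeOf (p : ι → ι → 𝕜ˣ) (g : grp p) (x : FreeAlgebra 𝕜 ι) :
    grpOf p g * freeOf p x = freeOf p (g • x) * grpOf p g := by
  rw [← sgl_eq]
  change sgl p g 1 * sgl p 1 x = _
  rw [sgl_mul_sgl, one_mul, mul_one]

theorem x_mul_g (p : ι → ι → 𝕜ˣ) (i : ι) (g : grp p) :
    xOf p i * grpOf p g = (chi p i g : 𝕜) • (grpOf p g * xOf p i) := by
  rw [xOf, grpOf_mul_freeOf, ← smul_mul_assoc, ← map_smul]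
  congr 2
  simp [smul_def, actHom, Units.smul_def, smul_smul]

theorem induct {p : ι → ι → 𝕜ˣ} (P : GX p → Prop) (hx : ∀ i, P (xOf p i))
    (hg : ∀ g, P (grpOf p g)) (hc : ∀ c : 𝕜, P (algebraMap 𝕜 _ c))
    (hadd : ∀ a b, P a → P b → P (a + b)) (hmul : ∀ a b, P a → P b → P (a * b)) (a : GX p) :
    P a := by
  have hf : ∀ x, P (freeOf p x) := by
    intro x
    induction x with
    | grade0 r => simpa using hc r
    | grade1 i => exact hx i
    | mul a b ha hb => rw [map_mul]; exact hmul _ _ ha hb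
    | add a b ha hb => rw [map_add]; exact hadd _ _ ha hb
  have h0 : P 0 := by simpa using hc 0
  refine SkewMonoidAlgebra.induction_on (p := P) a h0 ?_ (fun {a b} => hadd a b)
  intro g x
  change P (sgl p g x)
  rw [sgl_eq]
  exact hmul _ _ (hf x) (hg g)

theorem hom_ext {B : Type*} [Semiring B] [Algebra 𝕜 B] {p : ι → ι → 𝕜ˣ} {f f' : GX p →ₐ[𝕜] B}
    (hx : ∀ i, f (xOf p i) = f' (xOf p i)) (hg : ∀ g, f (grpOf p g) = f' (grpOf p g)) : f = f' := by
  refine AlgHom.ext fun a => ?_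
  induction a using induct with
  | hx i => exact hx i
  | hg g => exact hg g
  | hc c => simp
  | hadd a b ha hb => rw [map_add, map_add, ha, hb]
  | hmul a b ha hb => rw [map_mul, map_mul, ha, hb]

theorem smul_comm_of_gen {B : Type*} [Semiring B] [Algebra 𝕜 B] (p : ι → ι → 𝕜ˣ)
    (f : FreeAlgebra 𝕜 ι →ₐ[𝕜] B) (c : grp p →* B)
    (h : ∀ i g, f (FreeAlgebra.ι 𝕜 i) * c g
      = (chi p i g : 𝕜) • (c g * f (FreeAlgebra.ι 𝕜 i)))
    (g : grp p) (x : FreeAlgebra 𝕜 ι) : f (g • x) * c g = c g * f x := by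
  induction x with
  | grade0 r => simp [Algebra.commutes]
  | grade1 i => simp [smul_def, actHom, Units.smul_def, h, smul_smul]
  | mul a b ha hb => rw [smul_mul', map_mul, mul_assoc, hb, ← mul_assoc, ha, mul_assoc, map_mul]
  | add a b ha hb => rw [smul_add, map_add, map_add, add_mul, mul_add, ha, hb]

/-- The universal property of `G⟨X⟩`: generators `x_i`, `g ∈ G`, commutation rules
`x_i g = χ^i(g) g x_i`. -/
noncomputable def liftGX {B : Type*} [Semiring B] [Algebra 𝕜 B] (p : ι → ι → 𝕜ˣ)
    (a : ι → B) (c : grp p →* B) (h : ∀ i g, a i * c g = (chi p i g : 𝕜) • (c g * a i)) :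
    GX p →ₐ[𝕜] B :=
  SkewMonoidAlgebra.liftNCAlgHom (FreeAlgebra.lift 𝕜 a) c fun {x y} =>
    smul_comm_of_gen p (FreeAlgebra.lift 𝕜 a) c (by simpa using h) y x

theorem liftGX_sgl {B : Type*} [Semiring B] [Algebra 𝕜 B] (p : ι → ι → 𝕜ˣ)
    (a : ι → B) (c : grp p →* B) (h : ∀ i g, a i * c g = (chi p i g : 𝕜) • (c g * a i))
    (g : grp p) (x : FreeAlgebra 𝕜 ι) :
    liftGX p a c h (sgl p g x) = FreeAlgebra.lift 𝕜 a x * c g :=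
  SkewMonoidAlgebra.liftNC_single _ _ _ _

@[simp] theorem liftGX_x {B : Type*} [Semiring B] [Algebra 𝕜 B] (p : ι → ι → 𝕜ˣ)
    (a : ι → B) (c : grp p →* B) (h : ∀ i g, a i * c g = (chi p i g : 𝕜) • (c g * a i)) (i : ι) :
    liftGX p a c h (xOf p i) = a i := by
  have := liftGX_sgl p a c h 1 (FreeAlgebra.ι 𝕜 i)
  rwa [FreeAlgebra.lift_ι_apply, map_one, mul_one] at this

@[simp] theorem liftGX_grp {B : Type*} [Semiring B] [Algebra 𝕜 B] (p : ι → ι → 𝕜ˣ)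
    (a : ι → B) (c : grp p →* B) (h : ∀ i g, a i * c g = (chi p i g : 𝕜) • (c g * a i))
    (g : grp p) : liftGX p a c h (grpOf p g) = c g := by
  have := liftGX_sgl p a c h g 1
  rwa [map_one, one_mul] at this

/-- `g ↦ g ⊗ g`. -/
noncomputable def comulGrp (p : ι → ι → 𝕜ˣ) : grp p →* GX p ⊗[𝕜] GX p where
  toFun g := grpOf p g ⊗ₜ grpOf p g
  map_one' := by simp [Algebra.TensorProduct.one_def]
  map_mul' g h := by simp

@[simp] theorem comulGrp_apply (p : ι → ι → 𝕜ˣ) (g : grp p) :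
    comulGrp p g = grpOf p g ⊗ₜ[𝕜] grpOf p g := rfl

/-- `g ↦ g⁻¹`, as a homomorphism to the opposite algebra. -/
noncomputable def antipodeGrp (p : ι → ι → 𝕜ˣ) : grp p →* (GX p)ᵐᵒᵖ where
  toFun g := MulOpposite.op (grpOf p g⁻¹)
  map_one' := by simp
  map_mul' g h := by rw [← MulOpposite.op_mul, ← map_mul, mul_inv_rev]

@[simp] theorem antipodeGrp_apply (p : ι → ι → 𝕜ˣ) (g : grp p) :
    antipodeGrp p g = MulOpposite.op (grpOf p g⁻¹) := rfl

/-- `Δ(x_i) = x_i ⊗ 1 + g_i ⊗ x_i`, `Δ(g) = g ⊗ g`. -/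
noncomputable def comulGX (p : ι → ι → 𝕜ˣ) : GX p →ₐ[𝕜] GX p ⊗[𝕜] GX p :=
  liftGX p (fun i => xOf p i ⊗ₜ 1 + grpOf p (gGen p i) ⊗ₜ xOf p i) (comulGrp p)
    (by
      intro i g
      have hc : grpOf p (gGen p i) * grpOf p g = grpOf p g * grpOf p (gGen p i) := by
        rw [← map_mul, ← map_mul, mul_comm]
      simp only [comulGrp_apply, add_mul, mul_add, Algebra.TensorProduct.tmul_mul_tmul, one_mul,
        mul_one, x_mul_g, hc, smul_add, TensorProduct.smul_tmul', TensorProduct.tmul_smul])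

/-- `ε(x_i) = 0`, `ε(g) = 1`. -/
noncomputable def counitGX (p : ι → ι → 𝕜ˣ) : GX p →ₐ[𝕜] 𝕜 :=
  liftGX p (fun _ => 0) 1 (by simp)

/-- The anti-automorphism `S(x_i) = -g_i⁻¹ x_i`, `S(g) = g⁻¹`. -/
noncomputable def antipodeGX (p : ι → ι → 𝕜ˣ) : GX p →ₐ[𝕜] (GX p)ᵐᵒᵖ :=
  liftGX p (fun i => MulOpposite.op (-(grpOf p (gGen p i)⁻¹ * xOf p i))) (antipodeGrp p)
    (by
      intro i g
      have hc : grpOf p g⁻¹ * (grpOf p (gGen p i)⁻¹ * xOf p i)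
          = grpOf p (gGen p i)⁻¹ * (grpOf p g⁻¹ * xOf p i) := by
        rw [← mul_assoc, ← mul_assoc, ← map_mul, ← map_mul, mul_comm]
      rw [antipodeGrp_apply, ← MulOpposite.op_mul, ← MulOpposite.op_mul, ← MulOpposite.op_smul]
      congr 1
      rw [neg_mul, mul_neg, hc, mul_assoc, x_mul_g, mul_smul_comm, smul_neg, smul_smul]
      simp)

noncomputable instance instBialgebra (p : ι → ι → 𝕜ˣ) : Bialgebra 𝕜 (GX p) :=
  Bialgebra.ofAlgHom (comulGX p) (counitGX p)
    (by
      apply hom_ext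
      · intro i
        simp [comulGX, Algebra.TensorProduct.one_def, TensorProduct.add_tmul,
          TensorProduct.tmul_add, add_assoc]
      · intro g; simp [comulGX])
    (by
      apply hom_ext
      · intro i; simp [comulGX, counitGX]
      · intro g; simp [comulGX, counitGX])
    (by
      apply hom_ext
      · intro i; simp [comulGX, counitGX]
      · intro g; simp [comulGX, counitGX])

theorem comul_eq (p : ι → ι → 𝕜ˣ) (a : GX p) : Coalgebra.comul (R := 𝕜) a = comulGX p a := rfl

theorem counit_eq (p : ι → ι → 𝕜ˣ) (a : GX p) : Coalgebra.counit (R := 𝕜) a = counitGX p a := rfl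

/-- The antipode as a linear map. -/
noncomputable def antipodeLin (p : ι → ι → 𝕜ˣ) : GX p →ₗ[𝕜] GX p :=
  (MulOpposite.opLinearEquiv 𝕜).symm.toLinearMap ∘ₗ (antipodeGX p).toLinearMap

theorem antipodeLin_mul (p : ι → ι → 𝕜ˣ) (a b : GX p) :
    antipodeLin p (a * b) = antipodeLin p b * antipodeLin p a := by
  simp [antipodeLin]

theorem antipodeLin_x (p : ι → ι → 𝕜ˣ) (i : ι) :
    antipodeLin p (xOf p i) = -(grpOf p (gGen p i)⁻¹ * xOf p i) := by
  simp [antipodeLin, antipodeGX]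

theorem antipodeLin_g (p : ι → ι → 𝕜ˣ) (g : grp p) :
    antipodeLin p (grpOf p g) = grpOf p g⁻¹ := by
  simp [antipodeLin, antipodeGX]

theorem antipodeLin_one (p : ι → ι → 𝕜ˣ) : antipodeLin p 1 = 1 := by
  simp [antipodeLin]

theorem left_aux (p : ι → ι → 𝕜ˣ) (t : GX p ⊗[𝕜] GX p) (c : 𝕜)
    (ht : LinearMap.mul' 𝕜 (GX p) ((antipodeLin p).rTensor _ t) = algebraMap 𝕜 _ c)
    (s : GX p ⊗[𝕜] GX p) :
    LinearMap.mul' 𝕜 (GX p) ((antipodeLin p).rTensor _ (t * s))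
      = c • LinearMap.mul' 𝕜 (GX p) ((antipodeLin p).rTensor _ s) := by
  induction s with
  | zero => simp
  | add s s' hs hs' => rw [mul_add, map_add, map_add, map_add, map_add, hs, hs', smul_add]
  | tmul u v =>
    have key : LinearMap.mul' 𝕜 (GX p) ((antipodeLin p).rTensor _ (t * u ⊗ₜ[𝕜] v))
        = antipodeLin p u * LinearMap.mul' 𝕜 (GX p) ((antipodeLin p).rTensor _ t) * v := by
      clear ht
      induction t with
      | zero => simp
      | add t t' h h' => rw [add_mul, map_add, map_add, map_add, map_add, h, h', mul_add, add_mul]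
      | tmul a b => simp [antipodeLin_mul, mul_assoc]
    rw [key, ht, ← Algebra.commutes, mul_assoc, ← Algebra.smul_def]
    simp

theorem right_aux (p : ι → ι → 𝕜ˣ) (t s : GX p ⊗[𝕜] GX p) (c : 𝕜)
    (hs : LinearMap.mul' 𝕜 (GX p) ((antipodeLin p).lTensor _ s) = algebraMap 𝕜 _ c) :
    LinearMap.mul' 𝕜 (GX p) ((antipodeLin p).lTensor _ (t * s))
      = c • LinearMap.mul' 𝕜 (GX p) ((antipodeLin p).lTensor _ t) := by
  induction t with
  | zero => simp
  | add s s' hs hs' => rw [add_mul, map_add, map_add, map_add, map_add, hs, hs', smul_add]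
  | tmul u v =>
    have key : LinearMap.mul' 𝕜 (GX p) ((antipodeLin p).lTensor _ (u ⊗ₜ[𝕜] v * s))
        = u * LinearMap.mul' 𝕜 (GX p) ((antipodeLin p).lTensor _ s) * antipodeLin p v := by
      clear hs
      induction s with
      | zero => simp
      | add t t' h h' => rw [mul_add, map_add, map_add, map_add, map_add, h, h', mul_add, add_mul]
      | tmul a b => simp [antipodeLin_mul, mul_assoc]
    rw [key, hs, ← Algebra.commutes, mul_assoc, ← Algebra.smul_def]
    simp

/-- `G⟨X⟩` is a Hopf algebra. -/
noncomputable instance instHopf (p : ι → ι → 𝕜ˣ) : HopfAlgebra 𝕜 (GX p) where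
  antipode := antipodeLin p
  mul_antipode_rTensor_comul := by
    refine LinearMap.ext fun a => ?_
    change LinearMap.mul' 𝕜 (GX p) ((antipodeLin p).rTensor _ (comulGX p a))
      = algebraMap 𝕜 _ (counitGX p a)
    induction a using induct with
    | hx i => simp [comulGX, counitGX, antipodeLin_x, antipodeLin_g]
    | hg g => simp [comulGX, counitGX, antipodeLin_g, ← map_mul]
    | hc c => simp [Algebra.algebraMap_eq_smul_one, Algebra.TensorProduct.one_def, antipodeLin_one]
    | hadd a b ha hb => simp only [map_add, ha, hb]
    | hmul a b ha hb =>
      rw [map_mul, left_aux p _ _ ha, hb, map_mul, map_mul, Algebra.smul_def]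
  mul_antipode_lTensor_comul := by
    refine LinearMap.ext fun a => ?_
    change LinearMap.mul' 𝕜 (GX p) ((antipodeLin p).lTensor _ (comulGX p a))
      = algebraMap 𝕜 _ (counitGX p a)
    induction a using induct with
    | hx i =>
      simp [comulGX, counitGX, antipodeLin_x, antipodeLin_one, ← mul_assoc, ← map_mul]
    | hg g => simp [comulGX, counitGX, antipodeLin_g, ← map_mul]
    | hc c => simp [Algebra.algebraMap_eq_smul_one, Algebra.TensorProduct.one_def, antipodeLin_one]
    | hadd a b ha hb => simp only [map_add, ha, hb]
    | hmul a b ha hb =>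
      rw [map_mul, right_aux p _ _ _ hb, ha, map_mul, map_mul, Algebra.smul_def]
      exact Algebra.commutes _ _

end Letters

section Shuffle

variable {𝕜 ι : Type*} [Field 𝕜]

/-- The underlying space of the quantum shuffle algebra `Sh_τ(V)`, `V = ⨁ 𝕜 x_i`: the tensor space
`T(V)`, with basis the tensors `(z_1 z_2 … z_m) = z_1 ⊗ z_2 ⊗ ⋯ ⊗ z_m` in the letters `z_i`. The
braiding is `τ(u ⊗ v) = p(v, u)⁻¹ v ⊗ u`. -/
def Sh (_p : ι → ι → 𝕜ˣ) := List ι →₀ 𝕜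

noncomputable instance (p : ι → ι → 𝕜ˣ) : AddCommGroup (Sh p) :=
  inferInstanceAs (AddCommGroup (List ι →₀ 𝕜))

noncomputable instance (p : ι → ι → 𝕜ˣ) : Module 𝕜 (Sh p) :=
  inferInstanceAs (Module 𝕜 (List ι →₀ 𝕜))

/-- The tensor `(z_1 z_2 … z_m)`. -/
noncomputable def tens (p : ι → ι → 𝕜ˣ) (u : List ι) : Sh p := Finsupp.single u 1

/-- The linear extension of a map given on the tensors `(u)`. -/
noncomputable def ofTens {M : Type*} [AddCommGroup M] [Module 𝕜 M] (p : ι → ι → 𝕜ˣ)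
    (f : List ι → M) : Sh p →ₗ[𝕜] M :=
  Finsupp.linearCombination 𝕜 f

@[simp] theorem ofTens_tens {M : Type*} [AddCommGroup M] [Module 𝕜 M] (p : ι → ι → 𝕜ˣ)
    (f : List ι → M) (u : List ι) : ofTens p f (tens p u) = f u :=
  (Finsupp.linearCombination_single 𝕜 1 u).trans (one_smul 𝕜 _)

theorem Sh_lin_ext {M : Type*} [AddCommGroup M] [Module 𝕜 M] {p : ι → ι → 𝕜ˣ}
    {f g : Sh p →ₗ[𝕜] M} (h : ∀ u, f (tens p u) = g (tens p u)) : f = g :=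
  Finsupp.lhom_ext' fun u => LinearMap.ext_ring (h u)

/-- `(u) ↦ (x u)`. -/
noncomputable def consL (p : ι → ι → 𝕜ˣ) (x : ι) : Sh p →ₗ[𝕜] Sh p :=
  ofTens p fun u => tens p (x :: u)

/-- The shuffle product of two words, with the coefficients of the braiding:
`(x u)(y v) = x((u)(y v)) + p(y, x u)⁻¹ y((x u)(v))`. -/
noncomputable def shWord (p : ι → ι → 𝕜ˣ) : List ι → List ι → Sh p
  | [], v => tens p v
  | x :: u, [] => tens p (x :: u)
  | x :: u, y :: v => consL p x (shWord p u (y :: v))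
      + (((pw p [y] (x :: u))⁻¹ : 𝕜ˣ) : 𝕜) • consL p y (shWord p (x :: u) v)
termination_by u v => u.length + v.length

/-- The shuffle product. -/
noncomputable def shMul (p : ι → ι → 𝕜ˣ) : Sh p →ₗ[𝕜] Sh p →ₗ[𝕜] Sh p :=
  ofTens p fun u => ofTens p fun v => shWord p u v

/-- `(u) ↦ p(z, u)⁻¹ (u)`. -/
noncomputable def twist (p : ι → ι → 𝕜ˣ) (z : ι) : Sh p →ₗ[𝕜] Sh p :=
  ofTens p fun u => (((pw p [z] u)⁻¹ : 𝕜ˣ) : 𝕜) • tens p u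

theorem shMul_tens (p : ι → ι → 𝕜ˣ) (u v : List ι) :
    shMul p (tens p u) (tens p v) = shWord p u v := by simp [shMul]

theorem consL_tens (p : ι → ι → 𝕜ˣ) (x : ι) (u : List ι) :
    consL p x (tens p u) = tens p (x :: u) := by simp [consL]

theorem twist_tens (p : ι → ι → 𝕜ˣ) (z : ι) (u : List ι) :
    twist p z (tens p u) = (((pw p [z] u)⁻¹ : 𝕜ˣ) : 𝕜) • tens p u := by simp [twist]

theorem pw_cons (p : ι → ι → 𝕜ˣ) (z x : ι) (u : List ι) :
    pw p [z] (x :: u) = p z x * pw p [z] u := by simp [pw]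

theorem shWord_nil_left (p : ι → ι → 𝕜ˣ) (v : List ι) : shWord p [] v = tens p v := by
  rw [shWord]

theorem shWord_nil_right (p : ι → ι → 𝕜ˣ) (u : List ι) : shWord p u [] = tens p u := by
  cases u <;> rw [shWord]

theorem shMul_one_left (p : ι → ι → 𝕜ˣ) (a : Sh p) : shMul p (tens p []) a = a := by
  have : shMul p (tens p []) = LinearMap.id := Sh_lin_ext fun u => by
    rw [shMul_tens, shWord_nil_left]; rfl
  rw [this]; rfl

theorem shMul_one_right (p : ι → ι → 𝕜ˣ) (a : Sh p) : shMul p a (tens p []) = a := by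
  have : (shMul p).flip (tens p []) = LinearMap.id := Sh_lin_ext fun u => by
    rw [LinearMap.flip_apply, shMul_tens, shWord_nil_right]; rfl
  exact congrArg (fun f => f a) this

theorem twist_consL (p : ι → ι → 𝕜ˣ) (z x : ι) (a : Sh p) :
    twist p z (consL p x a) = (((p z x)⁻¹ : 𝕜ˣ) : 𝕜) • consL p x (twist p z a) := by
  have : (twist p z).comp (consL p x) = (((p z x)⁻¹ : 𝕜ˣ) : 𝕜) • (consL p x).comp (twist p z) :=
    Sh_lin_ext fun u => by
      simp only [LinearMap.comp_apply, LinearMap.smul_apply, consL_tens, twist_tens, map_smul,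
        smul_smul, pw_cons, mul_inv, Units.val_mul]
  exact congrArg (fun f => f a) this

theorem shMul_consL (p : ι → ι → 𝕜ˣ) (x y : ι) (a b : Sh p) :
    shMul p (consL p x a) (consL p y b) = consL p x (shMul p a (consL p y b))
      + consL p y (shMul p (twist p y (consL p x a)) b) := by
  have : (shMul p).compl₁₂ (consL p x) (consL p y)
      = ((shMul p).compl₂ (consL p y)).compr₂ (consL p x)
        + ((shMul p).comp ((twist p y).comp (consL p x))).compr₂ (consL p y) := by
    refine Sh_lin_ext fun u => Sh_lin_ext fun v => ?_
    simp only [LinearMap.compl₁₂_apply, LinearMap.add_apply, LinearMap.compr₂_apply,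
      LinearMap.compl₂_apply, LinearMap.comp_apply, consL_tens, twist_tens, map_smul,
      LinearMap.smul_apply, shMul_tens]
    rw [shWord]
  exact congrArg (fun f => f a b) this

theorem twist_shWord (p : ι → ι → 𝕜ˣ) (z : ι) (u v : List ι) :
    twist p z (shWord p u v)
      = (((pw p [z] u)⁻¹ * (pw p [z] v)⁻¹ : 𝕜ˣ) : 𝕜) • shWord p u v := by
  induction u, v using shWord.induct with
  | case1 v => simp [shWord_nil_left, twist_tens, pw]
  | case2 x u => simp [shWord_nil_right, twist_tens, pw]
  | case3 x u y v h1 h2 =>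
    rw [shWord, map_add, map_smul, twist_consL, twist_consL, h1, h2]
    simp only [map_smul, smul_add, smul_smul]
    congr 2
    · simp only [pw_cons, mul_inv, Units.val_mul]; ring
    · simp only [pw_cons, mul_inv, Units.val_mul]; ring

theorem twist_shMul (p : ι → ι → 𝕜ˣ) (z : ι) (a b : Sh p) :
    twist p z (shMul p a b) = shMul p (twist p z a) (twist p z b) := by
  have : (shMul p).compr₂ (twist p z) = (shMul p).compl₁₂ (twist p z) (twist p z) := by
    refine Sh_lin_ext fun u => Sh_lin_ext fun v => ?_
    simp only [LinearMap.compl₁₂_apply, LinearMap.compr₂_apply, shMul_tens, twist_shWord,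
      twist_tens, map_smul, LinearMap.smul_apply, smul_smul, Units.val_mul]
    rw [mul_comm]
  exact congrArg (fun f => f a b) this

theorem shMul_assoc_tens (p : ι → ι → 𝕜ˣ) (u v w : List ι) :
    shMul p (shMul p (tens p u) (tens p v)) (tens p w)
      = shMul p (tens p u) (shMul p (tens p v) (tens p w)) := by
  match u, v, w with
  | [], v, w => rw [shMul_one_left, shMul_one_left]
  | u, [], w => rw [shMul_one_left, shMul_one_right]
  | u, v, [] => rw [shMul_one_right, shMul_one_right]
  | x :: u, y :: v, z :: w =>
    have h1 := shMul_assoc_tens p u (y :: v) (z :: w)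
    have h2 := shMul_assoc_tens p (x :: u) v (z :: w)
    have h3 := shMul_assoc_tens p (x :: u) (y :: v) w
    have h2' : shMul p (shMul p (twist p y (tens p (x :: u))) (tens p v)) (tens p (z :: w))
        = shMul p (twist p y (tens p (x :: u))) (shMul p (tens p v) (tens p (z :: w))) := by
      simp only [twist_tens, map_smul, LinearMap.smul_apply, h2]
    have h3' : shMul p (twist p z (shMul p (tens p (x :: u)) (tens p (y :: v)))) (tens p w)
        = shMul p (twist p z (tens p (x :: u)))
            (shMul p (twist p z (tens p (y :: v))) (tens p w)) := by
      simp only [twist_shMul, twist_tens, map_smul, LinearMap.smul_apply, h3]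
    clear h2 h3
    simp only [← consL_tens] at h1 h2' h3' ⊢
    rw [shMul_consL p x y (tens p u)] at h3' ⊢
    rw [map_add, LinearMap.add_apply, shMul_consL p x z, shMul_consL p y z, h1, h2',
      shMul_consL p y z (tens p v), map_add, map_add, map_add, shMul_consL p x y,
      shMul_consL p x z, ← h3', map_add, map_add, LinearMap.add_apply, map_add]
    abel
termination_by u.length + v.length + w.length

theorem shMul_assoc (p : ι → ι → 𝕜ˣ) (a b c : Sh p) :
    shMul p (shMul p a b) c = shMul p a (shMul p b c) := by
  have ha : ∀ v w, shMul p (shMul p a (tens p v)) (tens p w)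
      = shMul p a (shMul p (tens p v) (tens p w)) := fun v w => by
    have : ((shMul p).flip (tens p w)).comp ((shMul p).flip (tens p v))
        = (shMul p).flip (shMul p (tens p v) (tens p w)) :=
      Sh_lin_ext fun u => shMul_assoc_tens p u v w
    exact congrArg (fun f => f a) this
  have hb : ∀ w, shMul p (shMul p a b) (tens p w) = shMul p a (shMul p b (tens p w)) := fun w => by
    have : ((shMul p).flip (tens p w)).comp (shMul p a)
        = (shMul p a).comp ((shMul p).flip (tens p w)) :=
      Sh_lin_ext fun v => ha v w
    exact congrArg (fun f => f b) this
  have : shMul p (shMul p a b) = (shMul p a).comp (shMul p b) := Sh_lin_ext hb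
  exact congrArg (fun f => f c) this

/-- The quantum shuffle algebra `Sh_τ(V)`; its unit is the empty tensor. -/
noncomputable instance (p : ι → ι → 𝕜ˣ) : Ring (Sh p) :=
  { (inferInstance : AddCommGroup (Sh p)) with
    mul := fun a b => shMul p a b
    one := tens p []
    left_distrib := fun a b c => map_add (shMul p a) b c
    right_distrib := fun a b c => LinearMap.map_add₂ (shMul p) a b c
    zero_mul := fun a => LinearMap.map_zero₂ (shMul p) a
    mul_zero := fun a => map_zero (shMul p a)
    mul_assoc := shMul_assoc p
    one_mul := shMul_one_left p
    mul_one := shMul_one_right p }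

noncomputable instance (p : ι → ι → 𝕜ˣ) : Algebra 𝕜 (Sh p) :=
  Algebra.ofModule (fun r a b => LinearMap.map_smul₂ (shMul p) r a b)
    (fun r a b => map_smul (shMul p a) r b)

theorem tens_mul_tens (p : ι → ι → 𝕜ˣ) (u v : List ι) :
    tens p u * tens p v = shWord p u v := shMul_tens p u v

end Shuffle

section Quotients

variable {𝕜 ι : Type*} [Field 𝕜]

/-- The ideal `G⟨X⟩⁽²⁾` generated by all `x_i x_j`. -/
noncomputable def ideal2 (p : ι → ι → 𝕜ˣ) : Ideal (GX p) :=
  (TwoSidedIdeal.span {a | ∃ i j, a = xOf p i * xOf p j}).asIdeal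

/-- The biggest Hopf ideal `Λ` contained in `G⟨X⟩⁽²⁾`: the sum of all of them. -/
noncomputable def lam (p : ι → ι → 𝕜ˣ) : Ideal (GX p) :=
  sSup {I : Ideal (GX p) | I.IsTwoSided ∧ I.IsHopfIdeal 𝕜 ∧ I ≤ ideal2 p}

instance (p : ι → ι → 𝕜ˣ) : (lam p).IsTwoSided where
  mul_mem_of_left {a} b ha := by
    rw [lam, sSup_eq_iSup'] at ha ⊢
    refine Submodule.iSup_induction _ (motive := fun a => a * b ∈ _) ha ?_ ?_ ?_
    · intro I x hx
      have := I.2.1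
      exact Submodule.mem_iSup_of_mem I (Ideal.mul_mem_right b I.1 hx)
    · simp
    · intro x y hx hy
      rw [add_mul]
      exact add_mem hx hy

theorem lam_le (p : ι → ι → 𝕜ˣ) : lam p ≤ ideal2 p := sSup_le fun _ hI => hI.2.2

theorem le_lam (p : ι → ι → 𝕜ˣ) (I : Ideal (GX p)) (h : I.IsTwoSided) (h' : I.IsHopfIdeal 𝕜)
    (h2 : I ≤ ideal2 p) : I ≤ lam p := le_sSup ⟨h, h', h2⟩

/-- `Λ` is itself a Hopf ideal, hence by `lam_le` and `le_lam` the biggest one in `G⟨X⟩⁽²⁾`. -/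
theorem lam_isHopfIdeal (p : ι → ι → 𝕜ˣ) : (lam p).IsHopfIdeal 𝕜 := by
  have key : ∀ (P : GX p → Prop), P 0 → (∀ a b, P a → P b → P (a + b)) →
      (∀ I : Ideal (GX p), I.IsHopfIdeal 𝕜 → I ≤ lam p → ∀ x ∈ I, P x) → ∀ x ∈ lam p, P x := by
    intro P h0 hadd hI x hx
    rw [lam, sSup_eq_iSup'] at hx
    exact Submodule.iSup_induction _ (motive := P) hx
      (fun I x hx => hI I.1 I.2.2.1 (le_sSup I.2) x hx) h0 hadd
  have hco : ((lam p).restrictScalars 𝕜).IsCoideal := by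
    refine ⟨fun x hx => ?_, fun x hx => ?_⟩
    · refine key (fun x => Coalgebra.counit (R := 𝕜) x = 0) (map_zero _) ?_ ?_ x hx
      · intro a b ha hb; rw [map_add, ha, hb, add_zero]
      · intro I hI _ x hx
        exact hI.toIsCoideal.counit_eq_zero hx
    · refine key (fun x => TensorProduct.map ((lam p).restrictScalars 𝕜).mkQ
        ((lam p).restrictScalars 𝕜).mkQ (Coalgebra.comul x) = 0) (by simp) ?_ ?_ x hx
      · intro a b ha hb; rw [map_add, map_add, ha, hb, add_zero]
      · intro I hI hle x hx
        have h1 := hI.toIsCoideal.map_mkQ_comul_eq_zero hx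
        have h2 : ((lam p).restrictScalars 𝕜).mkQ = (Submodule.mapQ (I.restrictScalars 𝕜)
            ((lam p).restrictScalars 𝕜) LinearMap.id hle).comp (I.restrictScalars 𝕜).mkQ := by
          ext a; rfl
        rw [h2, TensorProduct.map_comp, LinearMap.comp_apply, h1, map_zero]
  refine { hco with antipode_mem := fun x hx => ?_ }
  refine key (fun x => HopfAlgebra.antipode 𝕜 x ∈ lam p) (by simp) ?_ ?_ x hx
  · intro a b ha hb; rw [map_add]; exact add_mem ha hb
  · intro I hI hle x hx
    exact hle (hI.antipode_mem hx)

/-- The subalgebra `A` of `H = G⟨X⟩ / I` generated by the values `a_i` of the variables `x_i`. -/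
noncomputable def posPart {p : ι → ι → 𝕜ˣ} (I : Ideal (GX p)) [I.IsTwoSided] :
    Subalgebra 𝕜 (GX p ⧸ I) :=
  Algebra.adjoin 𝕜 (Set.range fun i => Ideal.Quotient.mk I (xOf p i))

/-- The generator `a_i` of `A`. -/
noncomputable def posGen {p : ι → ι → 𝕜ˣ} (I : Ideal (GX p)) [I.IsTwoSided] (i : ι) : posPart I :=
  ⟨Ideal.Quotient.mk I (xOf p i), Algebra.subset_adjoin ⟨i, rfl⟩⟩

/-- The value in `A` of an element of the free algebra. -/
noncomputable def posVal {p : ι → ι → 𝕜ˣ} (I : Ideal (GX p)) [I.IsTwoSided] :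
    FreeAlgebra 𝕜 ι →ₐ[𝕜] posPart I :=
  FreeAlgebra.lift 𝕜 (posGen I)

/-- `ρ` is the shuffle representation of `A`: the homomorphism of algebras `a_i ↦ (x_i)`. -/
def IsShuffleRep {p : ι → ι → 𝕜ˣ} (I : Ideal (GX p)) [I.IsTwoSided]
    (ρ : posPart I →ₐ[𝕜] Sh p) : Prop :=
  ∀ i, ρ (posGen I i) = tens p [i]

/-- The word `z_1 z_2 ⋯ z_m` as an element of the free algebra. -/
noncomputable def word (u : List ι) : FreeAlgebra 𝕜 ι := (u.map (FreeAlgebra.ι 𝕜)).prod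

/-- The coefficients of an element of the free algebra in the basis of words. -/
noncomputable def wordCoeff (f : FreeAlgebra 𝕜 ι) : FreeMonoid ι →₀ 𝕜 :=
  (FreeAlgebra.equivMonoidAlgebraFreeMonoid f).coeff

/-- The skew bracket: the bilinear operation with `[u, v] = u v - p(u, v) v u` for words `u`, `v`. -/
noncomputable def br (p : ι → ι → 𝕜ˣ) (f g : FreeAlgebra 𝕜 ι) : FreeAlgebra 𝕜 ι :=
  (wordCoeff f).sum fun u r => (wordCoeff g).sum fun v s =>
    (r * s) • (word u.toList * word v.toList
      - (pw p u.toList v.toList : 𝕜) • (word v.toList * word u.toList))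

end Quotients

section TypeB

variable {𝕜 : Type*} [Field 𝕜] {n : ℕ} [NeZero n]

/-- The index in `Fin n` of `x_i`, `1 ≤ i ≤ 2 n`, where `x_i = x_{2 n - i + 1}` for `i > n`.
(The variable `x_i`, `1 ≤ i ≤ n`, has index `i - 1`.) -/
def idx (n : ℕ) [NeZero n] (i : ℕ) : Fin n := Fin.ofNat n (if i ≤ n then i - 1 else 2 * n - i)

/-- `ψ(i) = 2 n - i + 1`. -/
def psi (n i : ℕ) : ℕ := 2 * n + 1 - i

/-- `p_{ij}` for `1 ≤ i, j ≤ 2 n`. -/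
def pp (p : Fin n → Fin n → 𝕜ˣ) (i j : ℕ) : 𝕜ˣ := p (idx n i) (idx n j)

/-- The relations between the parameters `p_{ij}` and `q` for the Cartan matrix of type `B_n`. -/
structure IsTypeB (q : 𝕜ˣ) (p : Fin n → Fin n → 𝕜ˣ) : Prop where
  last : pp p n n = q
  diag : ∀ i, 1 ≤ i → i < n → pp p i i = q ^ 2
  adj : ∀ i, 1 ≤ i → i < n → pp p i (i + 1) * pp p (i + 1) i = (q ^ 2)⁻¹
  far : ∀ i j, 1 ≤ i → i + 1 < j → j ≤ n → pp p i j * pp p j i = 1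

/-- The variable `x_i`, `1 ≤ i ≤ 2 n`, in the free algebra. -/
noncomputable def xv (𝕜 : Type*) [Field 𝕜] (n : ℕ) [NeZero n] (i : ℕ) : FreeAlgebra 𝕜 (Fin n) :=
  FreeAlgebra.ι 𝕜 (idx n i)

/-- The left hand sides of the defining relations of `U_q⁺(so_{2n+1})`. -/
inductive SerreRel (p : Fin n → Fin n → 𝕜ˣ) : FreeAlgebra 𝕜 (Fin n) → Prop
  | left (i : ℕ) (h1 : 1 ≤ i) (h2 : i < n) :
      SerreRel p (br p (xv 𝕜 n i) (br p (xv 𝕜 n i) (xv 𝕜 n (i + 1))))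
  | far (i j : ℕ) (h1 : 1 ≤ i) (h2 : i + 1 < j) (h3 : j ≤ n) :
      SerreRel p (br p (xv 𝕜 n i) (xv 𝕜 n j))
  | right (i : ℕ) (h1 : 1 ≤ i) (h2 : i + 1 < n) :
      SerreRel p (br p (br p (xv 𝕜 n i) (xv 𝕜 n (i + 1))) (xv 𝕜 n (i + 1)))
  | last (h : 2 ≤ n) :
      SerreRel p (br p (br p (br p (xv 𝕜 n (n - 1)) (xv 𝕜 n n)) (xv 𝕜 n n)) (xv 𝕜 n n))

/-- The ideal of `G⟨X⟩` with `U_q⁺(so_{2n+1}) = G⟨X⟩ / serreIdeal p`. -/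
noncomputable def serreIdeal (p : Fin n → Fin n → 𝕜ˣ) : Ideal (GX p) :=
  (TwoSidedIdeal.span (freeOf p '' {f | SerreRel p f})).asIdeal

instance (p : Fin n → Fin n → 𝕜ˣ) : (serreIdeal p).IsTwoSided :=
  inferInstanceAs (TwoSidedIdeal.asIdeal _).IsTwoSided

/-- The word `u(k, m) = x_k x_{k+1} ⋯ x_m`. -/
def wd (n : ℕ) [NeZero n] (k m : ℕ) : List (Fin n) := (List.range' k (m + 1 - k)).map (idx n)

/-- The word `u(m, k) = x_m x_{m-1} ⋯ x_k`, for `k ≤ m`. -/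
def wdRev (n : ℕ) [NeZero n] (m k : ℕ) : List (Fin n) := (wd n k m).reverse

/-- `[[…[x_k, x_{k+1}], …], x_{k+d}]`. -/
noncomputable def leftBr (p : Fin n → Fin n → 𝕜ˣ) (k : ℕ) : ℕ → FreeAlgebra 𝕜 (Fin n)
  | 0 => xv 𝕜 n k
  | d + 1 => br p (leftBr p k d) (xv 𝕜 n (k + (d + 1)))

/-- `[x_k, [x_{k+1}, […, x_{k+d}]…]]`. -/
noncomputable def rightBr (p : Fin n → Fin n → 𝕜ˣ) (k : ℕ) : ℕ → FreeAlgebra 𝕜 (Fin n)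
  | 0 => xv 𝕜 n k
  | d + 1 => br p (xv 𝕜 n k) (rightBr p (k + 1) d)

/-- The bracketed word `u[k, m]`, `1 ≤ k ≤ m ≤ 2 n`. In the last case `m = ψ(k)`, and
`u[n+1, m]`, `u[k, n]` are bracketed by the second and by the first case. -/
noncomputable def uBr (p : Fin n → Fin n → 𝕜ˣ) (k m : ℕ) : FreeAlgebra 𝕜 (Fin n) :=
  if m < psi n k then leftBr p k (m - k)
  else if psi n k < m then rightBr p k (m - k)
  else (-((pw p (wd n (n + 1) m) (wd n k n))⁻¹ : 𝕜ˣ) : 𝕜) •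
    br p (rightBr p (n + 1) (m - (n + 1))) (leftBr p k (n - k))

/-- `ε_k^m`. -/
def eps (n : ℕ) (q : 𝕜ˣ) (k m : ℕ) : 𝕜ˣ :=
  if m = psi n k then (q ^ 3)⁻¹ else if k ≤ n ∧ n < m then q⁻¹ else 1

/-- `α_k^m = ε_k^m (q² - 1)^{m-k} ∏_{k ≤ i < j ≤ m} p_{ij}`. -/
def alpha (q : 𝕜ˣ) (p : Fin n → Fin n → 𝕜ˣ) (k m : ℕ) : 𝕜 :=
  (eps n q k m : 𝕜) * ((q : 𝕜) ^ 2 - 1) ^ (m - k) *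
    ∏ i ∈ Finset.Icc k m, ∏ j ∈ Finset.Ioc i m, (pp p i j : 𝕜)

end TypeB

end QBorel

/-!
The homomorphism `shHom` from the free algebra to the shuffle algebra, `x_i ↦ (x_i)`, decides
everything: a shuffle representation of the positive part of `G⟨X⟩ / I` is `shHom` read on
values, so that it is unique, and it exists as soon as `shHom` vanishes on the free algebra elements
of `I`. To see the latter, `G⟨X⟩` acts on the shuffle algebra by `shAct` (the letters by left
multiplication, `G` diagonally), and `shAct p f 1 = shHom p f` for `f` in the free algebra.

* For the Serre ideal the relations are checked in the shuffle algebra (`IsTypeB.shHom_serreRel`),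
  hence the ideal lies in the kernel of the action.
* For `Λ` no relations are needed. Removal of the first letter `z` of a tensor is a skew derivation,
  and under `a ↦ shAct p a 1` it corresponds to `(λ ⊗ id) ∘ Δ` on `G⟨X⟩`, where `λ` is the linear
  form dual to `x_z` (`tailL_shAct`). As `λ` and the counit vanish on the ideal generated by the
  `x_i x_j`, a coideal in it is stable under these derivations, and all coefficients of
  `shAct p a 1` vanish (`shAct_eq_zero_of_mem_coideal`).

The image of `u[k, m]` is found by computing skew commutators of words, with
`skew p r u v = (u)(v) - r p(u,v) (v)(u)`. The parameter `r` makes them satisfy a recursion on first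
letters (`skew_cons_cons`), in which only the symmetric factors `p(z, w) p(w, z)` change `r`; these
are powers of `q²` read off the Dynkin diagram. Bracketing a word with a letter gives one term for
each place where the letter can be inserted. For `m ≠ ψ(k)` all of them vanish or cancel, except the
insertion at the outer end (`IsTypeB.skew_wdRev_letter`, `IsTypeB.skew_letter_wdRev`). For
`m = ψ(k)` the two words are `x_k ⋯ x_n` and `x_n ⋯ x_k`. Descending induction on `i` shows that
the skew commutator of `x_i ⋯ x_n` and `x_n ⋯ x_k` is a multiple of the concatenation
(`IsTypeB.skew_wd_wdRev_last`), the other term of the recursion being zero because `x_i ⋯ x_n` skew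
commutes with `x_{n-1} ⋯ x_k` for `i < n` (`IsTypeB.skew_wd_wdRev`). The last fact uses that
`x_j ⋯ x_k` is up to a nonzero factor an iterated bracket, which is where `q² ≠ 1`, a
consequence of `q⁴ ≠ 1`, enters.
-/

namespace QBorel

/-! ### Skew commutators of words in the shuffle algebra -/

section SkewCommutator

variable {𝕜 ι : Type*} [Field 𝕜]

theorem pw_nil_left (p : ι → ι → 𝕜ˣ) (v : List ι) : pw p [] v = 1 := by simp [pw]

theorem pw_nil_right (p : ι → ι → 𝕜ˣ) (u : List ι) : pw p u [] = 1 := by simp [pw]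

theorem pw_cons_left (p : ι → ι → 𝕜ˣ) (x : ι) (u v : List ι) :
    pw p (x :: u) v = pw p [x] v * pw p u v := by simp [pw]

theorem pw_append_left (p : ι → ι → 𝕜ˣ) (u u' v : List ι) :
    pw p (u ++ u') v = pw p u v * pw p u' v := by simp [pw]

theorem pw_append_right (p : ι → ι → 𝕜ˣ) (u v v' : List ι) :
    pw p u (v ++ v') = pw p u v * pw p u v' := by
  simp [pw, List.prod_map_mul]

theorem pw_cons_right (p : ι → ι → 𝕜ˣ) (u : List ι) (y : ι) (v : List ι) :
    pw p u (y :: v) = pw p u [y] * pw p u v := pw_append_right p u [y] v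

theorem pw_perm (p : ι → ι → 𝕜ˣ) {u u' v v' : List ι} (hu : u.Perm u') (hv : v.Perm v') :
    pw p u v = pw p u' v' := by
  have h : ∀ x, (v.map fun y => p x y).prod = (v'.map fun y => p x y).prod :=
    fun x => (hv.map _).prod_eq
  simp only [pw, h]
  exact (hu.map _).prod_eq

/-- `p(z, w) p(w, z)` for a letter `z` and a word `w`. -/
def cw (p : ι → ι → 𝕜ˣ) (z : ι) (w : List ι) : 𝕜ˣ := pw p [z] w * pw p w [z]

theorem cw_nil (p : ι → ι → 𝕜ˣ) (z : ι) : cw p z [] = 1 := by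
  simp [cw, pw]

theorem cw_singleton (p : ι → ι → 𝕜ˣ) (z x : ι) : cw p z [x] = p z x * p x z := by
  simp [cw, pw]

theorem cw_append (p : ι → ι → 𝕜ˣ) (z : ι) (u v : List ι) :
    cw p z (u ++ v) = cw p z u * cw p z v := by
  simp only [cw, pw_append_left, pw_append_right]
  exact mul_mul_mul_comm _ _ _ _

theorem cw_cons (p : ι → ι → 𝕜ˣ) (z x : ι) (w : List ι) :
    cw p z (x :: w) = cw p z [x] * cw p z w := cw_append p z [x] w

theorem cw_perm (p : ι → ι → 𝕜ˣ) (z : ι) {u v : List ι} (h : u.Perm v) : cw p z u = cw p z v := by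
  rw [cw, cw, pw_perm p (List.Perm.refl _) h, pw_perm p h (List.Perm.refl _)]

theorem cw_eq_one (p : ι → ι → 𝕜ˣ) (z : ι) (w : List ι) (h : ∀ x ∈ w, cw p z [x] = 1) :
    cw p z w = 1 := by
  induction w with
  | nil => exact cw_nil p z
  | cons x w ih =>
    rw [cw_cons, h x (by simp), ih fun y hy => h y (by simp [hy]), one_mul]

/-- The inverse of `p(z, w)` is `p(w, z)` up to the symmetric factor `p(z, w) p(w, z)`. -/
theorem inv_pw_left (p : ι → ι → 𝕜ˣ) (z : ι) (w : List ι) :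
    (pw p [z] w)⁻¹ = (cw p z w)⁻¹ * pw p w [z] := by
  rw [cw, mul_inv, mul_assoc, inv_mul_cancel, mul_one]

theorem tens_nil (p : ι → ι → 𝕜ˣ) : tens p [] = 1 := rfl

/-- The product rule for the shuffle product of two nonempty words. -/
theorem tens_cons_mul_cons (p : ι → ι → 𝕜ˣ) (x y : ι) (u v : List ι) :
    tens p (x :: u) * tens p (y :: v) = consL p x (tens p u * tens p (y :: v))
      + (((pw p [y] (x :: u))⁻¹ : 𝕜ˣ) : 𝕜) • consL p y (tens p (x :: u) * tens p v) := by
  simp only [tens_mul_tens]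
  rw [shWord]

/-- The skew commutator `(u)(v) - r p(u,v) (v)(u)` in the shuffle algebra, with a further
parameter `r`. For `r = 1` it is the image of the bracket of two homogeneous elements; values
`r ≠ 1` occur in its expansion along first letters. -/
noncomputable def skew (p : ι → ι → 𝕜ˣ) (r : 𝕜) (u v : List ι) : Sh p :=
  tens p u * tens p v - (r * (pw p u v : 𝕜)) • (tens p v * tens p u)

theorem skew_nil_left (p : ι → ι → 𝕜ˣ) (r : 𝕜) (v : List ι) :
    skew p r [] v = (1 - r) • tens p v := by
  simp [skew, tens_nil, pw_nil_left, sub_smul]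

theorem skew_nil_right (p : ι → ι → 𝕜ˣ) (r : 𝕜) (u : List ι) :
    skew p r u [] = (1 - r) • tens p u := by
  simp [skew, tens_nil, pw_nil_right, sub_smul]

/-- Expansion of a skew commutator along the first letters: removing the first letter `y` of the
right hand word multiplies the parameter by `p(y, u) p(u, y)`. -/
theorem skew_cons_cons (p : ι → ι → 𝕜ˣ) (r : 𝕜) (x y : ι) (u v : List ι) :
    skew p r (x :: u) (y :: v) = consL p x (skew p r u (y :: v))
      + (((pw p [y] (x :: u))⁻¹ : 𝕜ˣ) : 𝕜) •
        consL p y (skew p (r * (cw p y (x :: u) : 𝕜)) (x :: u) v) := by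
  have h1 : r * (pw p (x :: u) (y :: v) : 𝕜) * (((pw p [x] (y :: v))⁻¹ : 𝕜ˣ) : 𝕜)
      = r * (pw p u (y :: v) : 𝕜) := by
    rw [pw_cons_left, mul_assoc, ← Units.val_mul, mul_right_comm, mul_inv_cancel, one_mul]
  have h2 : r * (pw p (x :: u) (y :: v) : 𝕜) = (((pw p [y] (x :: u))⁻¹ : 𝕜ˣ) : 𝕜) *
      (r * (cw p y (x :: u) : 𝕜) * (pw p (x :: u) v : 𝕜)) := by
    have : pw p (x :: u) (y :: v)
        = (pw p [y] (x :: u))⁻¹ * (cw p y (x :: u) * pw p (x :: u) v) := by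
      rw [cw, pw_cons_right p (x :: u)]
      group
    rw [this]
    push_cast
    ring
  rw [skew, tens_cons_mul_cons, tens_cons_mul_cons, skew, skew, map_sub, map_sub, smul_add,
    smul_smul, h1, h2, map_smul, map_smul, smul_sub, smul_smul]
  abel

/-- Expansion of the skew commutator of a letter with a word. -/
theorem skew_letter_cons (p : ι → ι → 𝕜ˣ) (r : 𝕜) (x y : ι) (v : List ι) :
    skew p r [x] (y :: v) = (1 - r) • tens p (x :: y :: v)
      + (((p y x)⁻¹ : 𝕜ˣ) : 𝕜) • consL p y (skew p (r * (cw p y [x] : 𝕜)) [x] v) := by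
  rw [skew_cons_cons, skew_nil_left, map_smul, consL_tens]
  simp [pw]

/-- Expansion of the skew commutator of a word with a letter. -/
theorem skew_cons_letter (p : ι → ι → 𝕜ˣ) (r : 𝕜) (x y : ι) (u : List ι) :
    skew p r (y :: u) [x] = consL p y (skew p r u [x])
      + ((((pw p [x] (y :: u))⁻¹ : 𝕜ˣ) : 𝕜) * (1 - r * (cw p x (y :: u) : 𝕜))) •
        tens p (x :: y :: u) := by
  rw [skew_cons_cons, skew_nil_right, map_smul, consL_tens, smul_smul]

/-- Two words skew commute if each letter of one is orthogonal to each letter of the other. -/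
theorem skew_eq_zero_of_orthogonal (p : ι → ι → 𝕜ˣ) (u v : List ι)
    (h : ∀ x ∈ u, ∀ y ∈ v, cw p y [x] = 1) : skew p 1 u v = 0 := by
  match u, v with
  | [], v => simp [skew_nil_left]
  | u, [] => simp [skew_nil_right]
  | x :: u, y :: v =>
    rw [skew_cons_cons, cw_eq_one p y (x :: u) fun z hz => h z hz y (by simp), Units.val_one,
      mul_one,
      skew_eq_zero_of_orthogonal p u (y :: v) fun z hz => h z (by simp [hz]),
      skew_eq_zero_of_orthogonal p (x :: u) v fun z hz t ht => h z hz t (by simp [ht])]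
    simp
termination_by u.length + v.length

theorem skew_eq_zero_iff (p : ι → ι → 𝕜ˣ) (u v : List ι) :
    skew p 1 u v = 0 ↔ tens p u * tens p v = (pw p u v : 𝕜) • (tens p v * tens p u) := by
  rw [skew, one_mul, sub_eq_zero]

end SkewCommutator

/-! ### The bracket on homogeneous elements of the free algebra -/

section Homogeneous

variable {𝕜 ι : Type*} [Field 𝕜]

theorem word_nil : word (𝕜 := 𝕜) ([] : List ι) = 1 := rfl

theorem word_append (u v : List ι) : word (𝕜 := 𝕜) (u ++ v) = word u * word v := by
  simp [word]

theorem wordCoeff_word (u : List ι) :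
    wordCoeff (𝕜 := 𝕜) (word u) = Finsupp.single (FreeMonoid.ofList u) 1 := by
  have : FreeAlgebra.equivMonoidAlgebraFreeMonoid (word (𝕜 := 𝕜) u)
      = MonoidAlgebra.single (FreeMonoid.ofList u) 1 := by
    induction u with
    | nil => simp [word_nil]; rfl
    | cons x u ih =>
      have hx : FreeAlgebra.equivMonoidAlgebraFreeMonoid (FreeAlgebra.ι 𝕜 x)
          = MonoidAlgebra.single (FreeMonoid.of x) 1 := by
        simp [FreeAlgebra.equivMonoidAlgebraFreeMonoid]
      have hw : word (𝕜 := 𝕜) (x :: u) = FreeAlgebra.ι 𝕜 x * word u := by simp [word]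
      rw [hw, map_mul, ih, hx, MonoidAlgebra.single_mul_single, one_mul]
      rfl
  rw [wordCoeff, this, MonoidAlgebra.coeff_single]

theorem wordCoeff_add (f g : FreeAlgebra 𝕜 ι) : wordCoeff (f + g) = wordCoeff f + wordCoeff g := by
  simp [wordCoeff]

theorem wordCoeff_smul (c : 𝕜) (f : FreeAlgebra 𝕜 ι) : wordCoeff (c • f) = c • wordCoeff f := by
  simp [wordCoeff]

theorem br_add_left (p : ι → ι → 𝕜ˣ) (f f' g : FreeAlgebra 𝕜 ι) :
    br p (f + f') g = br p f g + br p f' g := by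
  rw [br, wordCoeff_add, Finsupp.sum_add_index']
  · rfl
  · intro u; simp
  · intro u r r'; simp only [add_mul, add_smul, Finsupp.sum_add]

theorem br_add_right (p : ι → ι → 𝕜ˣ) (f g g' : FreeAlgebra 𝕜 ι) :
    br p f (g + g') = br p f g + br p f g' := by
  simp only [br, wordCoeff_add]
  rw [← Finsupp.sum_add]
  refine Finsupp.sum_congr fun u _ => ?_
  rw [Finsupp.sum_add_index']
  · intro u; simp
  · intro u r r'; simp only [mul_add, add_smul]

theorem br_smul_left (p : ι → ι → 𝕜ˣ) (c : 𝕜) (f g : FreeAlgebra 𝕜 ι) :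
    br p (c • f) g = c • br p f g := by
  rw [br, wordCoeff_smul, Finsupp.sum_smul_index' (by intro u; simp), br, Finsupp.smul_sum]
  refine Finsupp.sum_congr fun u _ => ?_
  rw [Finsupp.smul_sum]
  refine Finsupp.sum_congr fun v _ => ?_
  rw [smul_smul, smul_eq_mul, mul_assoc]

theorem br_smul_right (p : ι → ι → 𝕜ˣ) (c : 𝕜) (f g : FreeAlgebra 𝕜 ι) :
    br p f (c • g) = c • br p f g := by
  simp only [br, wordCoeff_smul]
  rw [Finsupp.smul_sum]
  refine Finsupp.sum_congr fun u _ => ?_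
  rw [Finsupp.sum_smul_index' (by intro u; simp), Finsupp.smul_sum]
  refine Finsupp.sum_congr fun v _ => ?_
  rw [smul_smul, smul_eq_mul, mul_left_comm]

theorem br_word_word (p : ι → ι → 𝕜ˣ) (u v : List ι) :
    br p (word u) (word v) = word u * word v - (pw p u v : 𝕜) • (word v * word u) := by
  rw [br, wordCoeff_word, wordCoeff_word, Finsupp.sum_single_index, Finsupp.sum_single_index]
  · simp
  · simp
  · simp

/-- `f` is homogeneous of the weight of the word `w`: a linear combination of the words that are
rearrangements of `w`. -/
def IsHomog (w : List ι) (f : FreeAlgebra 𝕜 ι) : Prop :=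
  f ∈ Submodule.span 𝕜 (word '' {u : List ι | u.Perm w})

theorem isHomog_word (u : List ι) : IsHomog (𝕜 := 𝕜) u (word u) :=
  Submodule.subset_span ⟨u, List.Perm.refl u, rfl⟩

theorem isHomog_letter (x : ι) : IsHomog (𝕜 := 𝕜) [x] (FreeAlgebra.ι 𝕜 x) := by
  simpa [word] using isHomog_word (𝕜 := 𝕜) [x]

theorem IsHomog.mul {u v : List ι} {f g : FreeAlgebra 𝕜 ι} (hf : IsHomog u f) (hg : IsHomog v g) :
    IsHomog (u ++ v) (f * g) := by
  have := Submodule.mul_mem_mul hf hg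
  rw [Submodule.span_mul_span] at this
  refine Submodule.span_mono ?_ this
  rintro _ ⟨_, ⟨u', hu, rfl⟩, _, ⟨v', hv, rfl⟩, rfl⟩
  exact ⟨u' ++ v', hu.append hv, word_append u' v'⟩

theorem IsHomog.perm {u v : List ι} {f : FreeAlgebra 𝕜 ι} (hf : IsHomog u f) (h : u.Perm v) :
    IsHomog v f := by
  refine Submodule.span_mono ?_ hf
  rintro _ ⟨u', hu, rfl⟩
  exact ⟨u', hu.trans h, rfl⟩

/-- On homogeneous elements the bracket is the skew commutator. -/
theorem IsHomog.br_eq (p : ι → ι → 𝕜ˣ) {u v : List ι} {f g : FreeAlgebra 𝕜 ι} (hf : IsHomog u f)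
    (hg : IsHomog v g) : br p f g = f * g - (pw p u v : 𝕜) • (g * f) := by
  induction hf using Submodule.span_induction with
  | mem f hf =>
    obtain ⟨u', hu, rfl⟩ := hf
    induction hg using Submodule.span_induction with
    | mem g hg =>
      obtain ⟨v', hv, rfl⟩ := hg
      rw [br_word_word, pw_perm p hu hv]
    | zero =>
      have : br p (word u') (0 : FreeAlgebra 𝕜 ι) = 0 := by
        simpa using br_smul_right p 0 (word u') 0
      simp [this]
    | add g g' _ _ h h' => rw [br_add_right, h, h', mul_add, add_mul, smul_add]; abel
    | smul c g _ h =>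
      rw [br_smul_right, h, mul_smul_comm, smul_mul_assoc, smul_sub, smul_comm c]
  | zero =>
    have : br p (0 : FreeAlgebra 𝕜 ι) g = 0 := by simpa using br_smul_left p 0 0 g
    simp [this]
  | add f f' _ _ h h' => rw [br_add_left, h, h', mul_add, add_mul, smul_add]; abel
  | smul c f _ h =>
    rw [br_smul_left, h, mul_smul_comm, smul_mul_assoc, smul_sub, smul_comm c]

theorem IsHomog.br (p : ι → ι → 𝕜ˣ) {u v : List ι} {f g : FreeAlgebra 𝕜 ι} (hf : IsHomog u f)
    (hg : IsHomog v g) : IsHomog (u ++ v) (br p f g) := by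
  rw [hf.br_eq p hg]
  exact Submodule.sub_mem _ (hf.mul hg)
    (Submodule.smul_mem _ _ ((hg.mul hf).perm List.perm_append_comm))

/-- The homomorphism from the free algebra to the shuffle algebra with `x_i ↦ (x_i)`. -/
noncomputable def shHom (p : ι → ι → 𝕜ˣ) : FreeAlgebra 𝕜 ι →ₐ[𝕜] Sh p :=
  FreeAlgebra.lift 𝕜 fun i => tens p [i]

@[simp] theorem shHom_letter (p : ι → ι → 𝕜ˣ) (i : ι) :
    shHom p (FreeAlgebra.ι 𝕜 i) = tens p [i] := by simp [shHom]

/-- The image of a bracket of homogeneous elements that represent multiples of single tensors. -/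
theorem shHom_br (p : ι → ι → 𝕜ˣ) {u v : List ι} {f g : FreeAlgebra 𝕜 ι} (hf : IsHomog u f)
    (hg : IsHomog v g) {u' v' : List ι} (hu : u.Perm u') (hv : v.Perm v') {a b : 𝕜}
    (hfa : shHom p f = a • tens p u') (hgb : shHom p g = b • tens p v') :
    shHom p (QBorel.br p f g) = (a * b) • skew p 1 u' v' := by
  rw [hf.br_eq p hg, map_sub, map_smul, map_mul, map_mul, hfa, hgb, skew, pw_perm p hu hv]
  simp only [smul_mul_smul_comm, smul_sub, smul_smul, one_mul]
  congr 2
  ring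

end Homogeneous

/-! ### The action of `G⟨X⟩` on the shuffle algebra -/

section Representation

variable {𝕜 ι : Type*} [Field 𝕜]

/-- The action of `g ∈ G` on the shuffle algebra: `(z_1 ⋯ z_r) ↦ (∏ χ^{z_i}(g)⁻¹) (z_1 ⋯ z_r)`. -/
noncomputable def diagAct (p : ι → ι → 𝕜ˣ) : grp p →* Module.End 𝕜 (Sh p) where
  toFun g := ofTens p fun u => (((u.map fun z => (chi p z g)⁻¹).prod : 𝕜ˣ) : 𝕜) • tens p u
  map_one' := Sh_lin_ext fun u => by simp
  map_mul' g h := Sh_lin_ext fun u => by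
    simp only [ofTens_tens, Module.End.mul_apply, map_smul, smul_smul, map_mul, mul_inv,
      List.prod_map_mul, Units.val_mul]
    rw [mul_comm]

theorem diagAct_tens (p : ι → ι → 𝕜ˣ) (g : grp p) (u : List ι) :
    diagAct p g (tens p u) = (((u.map fun z => (chi p z g)⁻¹).prod : 𝕜ˣ) : 𝕜) • tens p u :=
  ofTens_tens p _ u

theorem diagAct_consL (p : ι → ι → 𝕜ˣ) (g : grp p) (x : ι) (a : Sh p) :
    diagAct p g (consL p x a) = (((chi p x g)⁻¹ : 𝕜ˣ) : 𝕜) • consL p x (diagAct p g a) := by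
  have : diagAct p g ∘ₗ consL p x = (((chi p x g)⁻¹ : 𝕜ˣ) : 𝕜) • (consL p x ∘ₗ diagAct p g) :=
    Sh_lin_ext fun u => by
      simp only [LinearMap.comp_apply, LinearMap.smul_apply, consL_tens, diagAct_tens, map_smul,
        smul_smul, List.map_cons, List.prod_cons, Units.val_mul]
  exact congrArg (fun f => f a) this

/-- The group acts by automorphisms, as far as products with a letter are concerned. -/
theorem diagAct_letter_mul (p : ι → ι → 𝕜ˣ) (g : grp p) (x : ι) (u : List ι) :
    diagAct p g (tens p [x] * tens p u)
      = (((chi p x g)⁻¹ : 𝕜ˣ) : 𝕜) • (tens p [x] * diagAct p g (tens p u)) := by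
  induction u with
  | nil =>
    rw [diagAct_tens p g [], List.map_nil, List.prod_nil, Units.val_one, one_smul, tens_nil,
      mul_one, diagAct_tens]
    simp
  | cons y u ih =>
    have h : tens p [x] * tens p (y :: u) = tens p (x :: y :: u)
        + (((p y x)⁻¹ : 𝕜ˣ) : 𝕜) • consL p y (tens p [x] * tens p u) := by
      rw [tens_cons_mul_cons, tens_nil, one_mul, consL_tens]
      simp [pw]
    rw [diagAct_tens, mul_smul_comm, h, map_add, map_smul, diagAct_consL, ih, diagAct_tens,
      diagAct_tens]
    simp only [mul_smul_comm, map_smul, smul_add, smul_smul, List.map_cons, List.prod_cons,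
      Units.val_mul]
    congr 2
    ring

/-- The action of `G⟨X⟩` on the shuffle algebra: `x_i` acts as left multiplication by `(x_i)`, the
group `G` diagonally. -/
noncomputable def shAct (p : ι → ι → 𝕜ˣ) : GX p →ₐ[𝕜] Module.End 𝕜 (Sh p) :=
  liftGX p (fun i => LinearMap.mulLeft 𝕜 (tens p [i])) (diagAct p) (by
    intro i g
    refine Sh_lin_ext fun u => ?_
    rw [LinearMap.smul_apply, Module.End.mul_apply, Module.End.mul_apply,
      LinearMap.mulLeft_apply, LinearMap.mulLeft_apply, diagAct_letter_mul, smul_smul,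
      Units.mul_inv, one_smul])

theorem shAct_freeOf (p : ι → ι → 𝕜ˣ) (f : FreeAlgebra 𝕜 ι) (a : Sh p) :
    shAct p (freeOf p f) a = shHom p f * a := by
  have : (shAct p).comp (freeOf p) = (Algebra.lmul 𝕜 (Sh p)).comp (shHom p) := by
    refine FreeAlgebra.hom_ext (funext fun i => LinearMap.ext fun a => ?_)
    change shAct p (xOf p i) a = shHom p (FreeAlgebra.ι 𝕜 i) * a
    simp [shAct]
  exact congrArg (fun f' => f' f a) this

theorem shAct_freeOf_one (p : ι → ι → 𝕜ˣ) (f : FreeAlgebra 𝕜 ι) :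
    shAct p (freeOf p f) 1 = shHom p f := by rw [shAct_freeOf, mul_one]

/-! ### Existence and uniqueness of the shuffle representation -/

section Existence

variable {p : ι → ι → 𝕜ˣ} (I : Ideal (GX p)) [I.IsTwoSided]

theorem coe_posVal (f : FreeAlgebra 𝕜 ι) :
    ((posVal I f : posPart I) : GX p ⧸ I) = Ideal.Quotient.mk I (freeOf p f) := by
  have : (posPart I).val.comp (posVal I) = (Ideal.Quotient.mkₐ 𝕜 I).comp (freeOf p) := by
    refine FreeAlgebra.hom_ext (funext fun i => ?_)
    simp [posVal, posGen, xOf]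
  exact congrArg (fun f' => f' f) this

theorem posVal_surjective : Function.Surjective (posVal I) := by
  rintro ⟨a, ha⟩
  suffices ∃ f, ((posVal I f : posPart I) : GX p ⧸ I) = a by
    obtain ⟨f, hf⟩ := this
    exact ⟨f, Subtype.ext hf⟩
  rw [posPart] at ha
  induction ha using Algebra.adjoin_induction with
  | mem x hx =>
    obtain ⟨i, rfl⟩ := hx
    exact ⟨FreeAlgebra.ι 𝕜 i, coe_posVal I _⟩
  | algebraMap r => exact ⟨algebraMap 𝕜 _ r, by simp⟩
  | add x y _ _ hx hy =>
    obtain ⟨f, rfl⟩ := hx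
    obtain ⟨g, rfl⟩ := hy
    exact ⟨f + g, by simp⟩
  | mul x y _ _ hx hy =>
    obtain ⟨f, rfl⟩ := hx
    obtain ⟨g, rfl⟩ := hy
    exact ⟨f * g, by simp⟩

theorem IsShuffleRep.apply_posVal {ρ : posPart I →ₐ[𝕜] Sh p} (h : IsShuffleRep I ρ)
    (f : FreeAlgebra 𝕜 ι) : ρ (posVal I f) = shHom p f := by
  have : ρ.comp (posVal I) = shHom p := by
    refine FreeAlgebra.hom_ext (funext fun i => ?_)
    simp [posVal, h i]
  exact congrArg (fun f' => f' f) this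

/-- If `I` annihilates the unit of the shuffle algebra, the shuffle representation of the positive
part of `G⟨X⟩ / I` exists and is unique. -/
theorem existsUnique_isShuffleRep (h : ∀ a ∈ I, shAct p a 1 = 0) :
    ∃! ρ : posPart I →ₐ[𝕜] Sh p, IsShuffleRep I ρ := by
  -- `shHom p` factors through the surjection `posVal I`.
  have key : ∀ f g, posVal I f = posVal I g → shHom p f = shHom p g := by
    intro f g hfg
    have h1 := congrArg (Subtype.val) hfg
    rw [coe_posVal, coe_posVal, Ideal.Quotient.eq, ← map_sub] at h1
    have h2 := h _ h1
    rwa [shAct_freeOf_one, map_sub, sub_eq_zero] at h2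
  have hs := Function.surjInv_eq (posVal_surjective I)
  refine ⟨AlgHom.ofLinearMap
    { toFun := fun a => shHom p (Function.surjInv (posVal_surjective I) a)
      map_add' := fun a b => ?_
      map_smul' := fun c a => ?_ } ?_ fun a b => ?_, fun i => ?_, fun ρ hρ => ?_⟩
  · rw [← map_add]; apply key; rw [map_add, hs, hs, hs]
  · rw [RingHom.id_apply, ← map_smul]; apply key; rw [map_smul, hs, hs]
  · change shHom p _ = 1
    rw [← map_one (shHom p)]; apply key; rw [hs, map_one]
  · change shHom p _ = shHom p _ * shHom p _
    rw [← map_mul]; apply key; rw [map_mul, hs, hs, hs]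
  · change shHom p _ = _
    rw [← shHom_letter]; apply key; rw [hs]; simp [posVal]
  · refine AlgHom.ext fun a => ?_
    change _ = shHom p _
    rw [← hρ.apply_posVal, hs]

end Existence

/-! ### Skew derivations and Hopf ideals -/

section HopfIdeal

/-- The map `(f ⊗ id) ∘ Δ` for a linear functional `f`. -/
noncomputable def hit (p : ι → ι → 𝕜ˣ) (f : GX p →ₗ[𝕜] 𝕜) : GX p →ₗ[𝕜] GX p :=
  TensorProduct.lid 𝕜 (GX p) ∘ₗ f.rTensor (GX p) ∘ₗ (comulGX p).toLinearMap

theorem hit_zero (p : ι → ι → 𝕜ˣ) (a : GX p) : hit p 0 a = 0 := by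
  simp [hit]

theorem hit_x (p : ι → ι → 𝕜ˣ) (f : GX p →ₗ[𝕜] 𝕜) (i : ι) :
    hit p f (xOf p i) = f (xOf p i) • 1 + f (grpOf p (gGen p i)) • xOf p i := by
  simp [hit, comulGX]

theorem hit_grp (p : ι → ι → 𝕜ˣ) (f : GX p →ₗ[𝕜] 𝕜) (g : grp p) :
    hit p f (grpOf p g) = f (grpOf p g) • grpOf p g := by
  simp [hit, comulGX]

theorem hit_algebraMap (p : ι → ι → 𝕜ˣ) (f : GX p →ₗ[𝕜] 𝕜) (c : 𝕜) :
    hit p f (algebraMap 𝕜 _ c) = (c * f 1) • 1 := by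
  simp [hit, Algebra.algebraMap_eq_smul_one, Algebra.TensorProduct.one_def, smul_smul]

/-- A coideal is stable under `(f ⊗ id) ∘ Δ` if `f` vanishes on it. -/
theorem hit_mem (p : ι → ι → 𝕜ˣ) (f : GX p →ₗ[𝕜] 𝕜) (I : Submodule 𝕜 (GX p)) [I.IsCoideal]
    (hf : ∀ a ∈ I, f a = 0) {a : GX p} (ha : a ∈ I) : hit p f a ∈ I := by
  have h1 := Submodule.IsCoideal.map_mkQ_comul_eq_zero (I := I) ha
  have h2 : I.mkQ ∘ₗ (TensorProduct.lid 𝕜 (GX p)).toLinearMap ∘ₗ f.rTensor (GX p)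
      = (TensorProduct.lid 𝕜 (GX p ⧸ I)).toLinearMap ∘ₗ (I.liftQ f hf).rTensor (GX p ⧸ I) ∘ₗ
        TensorProduct.map I.mkQ I.mkQ := by
    ext a b
    simp [-Submodule.mkQ_apply, show I.liftQ f hf (I.mkQ a) = f a from I.liftQ_apply f a]
  rw [← Submodule.Quotient.mk_eq_zero, ← Submodule.mkQ_apply]
  have h3 := congrArg (fun F => F (comulGX p a)) h2
  simp only [LinearMap.comp_apply] at h3
  rw [comul_eq] at h1
  rw [h1, map_zero, map_zero] at h3
  exact h3

/-- If `f(a b) = f₁(a) f₂(b) + f₃(a) f(b)`, then `(f ⊗ id) ∘ Δ` satisfies the analogous rule. -/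
theorem hit_mul (p : ι → ι → 𝕜ˣ) (f f₁ f₂ f₃ : GX p →ₗ[𝕜] 𝕜)
    (h : ∀ a b, f (a * b) = f₁ a * f₂ b + f₃ a * f b) (a b : GX p) :
    hit p f (a * b) = hit p f₁ a * hit p f₂ b + hit p f₃ a * hit p f b := by
  have key : ∀ s t : GX p ⊗[𝕜] GX p,
      TensorProduct.lid 𝕜 (GX p) (f.rTensor _ (s * t))
        = TensorProduct.lid 𝕜 (GX p) (f₁.rTensor _ s) * TensorProduct.lid 𝕜 (GX p) (f₂.rTensor _ t)
          + TensorProduct.lid 𝕜 (GX p) (f₃.rTensor _ s)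
            * TensorProduct.lid 𝕜 (GX p) (f.rTensor _ t) := by
    intro s t
    induction s with
    | zero => simp
    | add s s' hs hs' => simp only [add_mul, map_add, hs, hs']; abel
    | tmul a b =>
      induction t with
      | zero => simp
      | add t t' ht ht' => simp only [mul_add, map_add, ht, ht']; abel
      | tmul c d => simp [h, add_smul, smul_smul, mul_comm]
  simp only [hit, LinearMap.comp_apply, AlgHom.toLinearMap_apply, map_mul]
  exact key _ _

/-- The representation of `G⟨X⟩` by triangular matrices with `g ↦ diag(χ^z(g)⁻¹, 1)`,
`x_z ↦ E_{01}` and `x_i ↦ 0` for `i ≠ z`. Its entry `01` is a skew derivation dual to `x_z`. -/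
noncomputable def triRep [DecidableEq ι] (p : ι → ι → 𝕜ˣ) (z : ι) :
    GX p →ₐ[𝕜] Matrix (Fin 2) (Fin 2) 𝕜 :=
  liftGX p (fun i => if i = z then !![0, 1; 0, 0] else 0)
    { toFun := fun g => !![(((chi p z g)⁻¹ : 𝕜ˣ) : 𝕜), 0; 0, 1]
      map_one' := by simp [Matrix.one_fin_two]
      map_mul' := fun g h => by simp [mul_comm] }
    (by
      intro i g
      by_cases h : i = z
      · subst h
        ext a b
        fin_cases a <;> fin_cases b <;> simp
      · simp [h])

variable [DecidableEq ι]

/-- The entries of `triRep` as linear functionals. -/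
noncomputable def triEntry (p : ι → ι → 𝕜ˣ) (z : ι) (i j : Fin 2) : GX p →ₗ[𝕜] 𝕜 :=
  Matrix.entryLinearMap 𝕜 𝕜 i j ∘ₗ (triRep p z).toLinearMap

theorem triEntry_apply (p : ι → ι → 𝕜ˣ) (z : ι) (i j : Fin 2) (a : GX p) :
    triEntry p z i j a = triRep p z a i j := rfl

theorem triRep_x (p : ι → ι → 𝕜ˣ) (z i : ι) :
    triRep p z (xOf p i) = if i = z then !![0, 1; 0, 0] else 0 := by simp [triRep]

theorem triRep_grp (p : ι → ι → 𝕜ˣ) (z : ι) (g : grp p) :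
    triRep p z (grpOf p g) = !![(((chi p z g)⁻¹ : 𝕜ˣ) : 𝕜), 0; 0, 1] := by simp [triRep]

theorem triRep_one_zero (p : ι → ι → 𝕜ˣ) (z : ι) (a : GX p) : triRep p z a 1 0 = 0 := by
  induction a using induct with
  | hx i => rw [triRep_x]; split_ifs <;> simp
  | hg g => rw [triRep_grp]; simp
  | hc c => simp [Matrix.algebraMap_matrix_apply]
  | hadd a b ha hb => simp [ha, hb]
  | hmul a b ha hb => simp [Matrix.mul_apply, Fin.sum_univ_two, ha, hb]

theorem triEntry_zero_one_mul (p : ι → ι → 𝕜ˣ) (z : ι) (a b : GX p) :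
    triEntry p z 0 1 (a * b)
      = triEntry p z 0 1 a * triEntry p z 1 1 b + triEntry p z 0 0 a * triEntry p z 0 1 b := by
  simp only [triEntry_apply, map_mul, Matrix.mul_apply, Fin.sum_univ_two]
  ring

/-- The diagonal entries are multiplicative. The rule is put in the form required by `hit_mul`. -/
theorem triEntry_diag_mul (p : ι → ι → 𝕜ˣ) (z : ι) (i : Fin 2) (a b : GX p) :
    triEntry p z i i (a * b) = triEntry p z i i a * triEntry p z i i b + (0 : GX p →ₗ[𝕜] 𝕜) a *
      triEntry p z i i b := by
  have ha := triRep_one_zero p z a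
  have hb := triRep_one_zero p z b
  fin_cases i <;>
    simp [triEntry_apply, Matrix.mul_apply, Fin.sum_univ_two, ha, hb]

/-- All products `x_i x_j` act by zero in `triRep`, as `E_{01}` squares to zero. -/
theorem triRep_eq_zero (p : ι → ι → 𝕜ˣ) (z : ι) {a : GX p} (ha : a ∈ ideal2 p) :
    triRep p z a = 0 := by
  rw [ideal2, TwoSidedIdeal.mem_asIdeal] at ha
  have h : TwoSidedIdeal.span {a | ∃ i j, a = xOf p i * xOf p j}
      ≤ TwoSidedIdeal.ker (triRep p z) := by
    rw [TwoSidedIdeal.span_le]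
    rintro _ ⟨i, j, rfl⟩
    rw [SetLike.mem_coe, TwoSidedIdeal.mem_ker, map_mul, triRep_x, triRep_x]
    have h0 : (!![0, 1; 0, 0] * !![0, 1; 0, 0] : Matrix (Fin 2) (Fin 2) 𝕜) = 0 := by
      ext a b
      fin_cases a <;> fin_cases b <;> simp
    split_ifs <;> simp [h0]
  exact (TwoSidedIdeal.mem_ker _).1 (h ha)

theorem hit_diag_mul (p : ι → ι → 𝕜ˣ) (z : ι) (i : Fin 2) (a b : GX p) :
    hit p (triEntry p z i i) (a * b) = hit p (triEntry p z i i) a * hit p (triEntry p z i i) b := by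
  rw [hit_mul p _ _ _ _ (triEntry_diag_mul p z i), hit_zero, zero_mul, add_zero]

/-- The entry `11` of `triRep` is the counit. -/
theorem hit_triEntry_one_one (p : ι → ι → 𝕜ˣ) (z : ι) (a : GX p) :
    hit p (triEntry p z 1 1) a = a := by
  induction a using induct with
  | hx i =>
    rw [hit_x, triEntry_apply, triEntry_apply, triRep_x, triRep_grp]
    split_ifs <;> simp
  | hg g => rw [hit_grp, triEntry_apply, triRep_grp]; simp
  | hc c =>
    rw [hit_algebraMap, triEntry_apply]
    simp [Algebra.algebraMap_eq_smul_one]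
  | hadd a b ha hb => rw [map_add, ha, hb]
  | hmul a b ha hb => rw [hit_diag_mul, ha, hb]

/-- Removal of the first letter: `(z u) ↦ (u)`, and `0` on the words that do not start with `z`. -/
noncomputable def tailL (p : ι → ι → 𝕜ˣ) (z : ι) : Sh p →ₗ[𝕜] Sh p :=
  ofTens p fun
    | [] => 0
    | x :: u => if x = z then tens p u else 0

theorem tailL_nil (p : ι → ι → 𝕜ˣ) (z : ι) : tailL p z (tens p []) = 0 := by simp [tailL]

theorem tailL_consL (p : ι → ι → 𝕜ˣ) (z x : ι) (a : Sh p) :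
    tailL p z (consL p x a) = if x = z then a else 0 := by
  by_cases h : x = z
  · have : tailL p z ∘ₗ consL p x = LinearMap.id :=
      Sh_lin_ext fun u => by simp [consL_tens, tailL, h]
    simpa [h] using congrArg (fun f => f a) this
  · have : tailL p z ∘ₗ consL p x = 0 :=
      Sh_lin_ext fun u => by simp [consL_tens, tailL, h]
    simpa [h] using congrArg (fun f => f a) this

theorem tailL_diagAct (p : ι → ι → 𝕜ˣ) (z : ι) (g : grp p) (a : Sh p) :
    tailL p z (diagAct p g a) = (((chi p z g)⁻¹ : 𝕜ˣ) : 𝕜) • diagAct p g (tailL p z a) := by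
  have : tailL p z ∘ₗ diagAct p g = (((chi p z g)⁻¹ : 𝕜ˣ) : 𝕜) • (diagAct p g ∘ₗ tailL p z) := by
    refine Sh_lin_ext fun u => ?_
    simp only [LinearMap.comp_apply, LinearMap.smul_apply, diagAct_tens, map_smul]
    cases u with
    | nil => simp [tailL_nil]
    | cons x u =>
      rw [← consL_tens, tailL_consL]
      split_ifs with h
      · simp [h, diagAct_tens, smul_smul]
      · simp
  exact congrArg (fun f => f a) this

theorem tailL_letter_mul (p : ι → ι → 𝕜ˣ) (z x : ι) (a : Sh p) :
    tailL p z (tens p [x] * a) = (if x = z then a else 0)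
      + (((p z x)⁻¹ : 𝕜ˣ) : 𝕜) • (tens p [x] * tailL p z a) := by
  have : tailL p z ∘ₗ LinearMap.mulLeft 𝕜 (tens p [x])
      = (if x = z then LinearMap.id else 0)
        + (((p z x)⁻¹ : 𝕜ˣ) : 𝕜) • (LinearMap.mulLeft 𝕜 (tens p [x]) ∘ₗ tailL p z) := by
    refine Sh_lin_ext fun u => ?_
    simp only [LinearMap.comp_apply, LinearMap.smul_apply, LinearMap.add_apply,
      LinearMap.mulLeft_apply]
    cases u with
    | nil =>
      rw [tailL_nil, tens_nil, mul_one, mul_zero, smul_zero, add_zero, ← tens_nil p,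
        ← consL_tens, tailL_consL]
      split_ifs <;> simp
    | cons y u =>
      rw [tens_cons_mul_cons, map_add, map_smul, tailL_consL, tailL_consL, tens_nil, one_mul,
        ← consL_tens p y, tailL_consL]
      congr 1
      · split_ifs <;> simp
      · split_ifs with h
        · simp [h, pw]
        · simp
  have h2 := congrArg (fun f => f a) this
  simp only [LinearMap.comp_apply, LinearMap.smul_apply, LinearMap.add_apply,
    LinearMap.mulLeft_apply] at h2
  rw [h2]
  split_ifs <;> simp

/-- Removal of the first letter `z` is a skew derivation for the action of `G⟨X⟩`; the derivation
on `G⟨X⟩` is `(f ⊗ id) ∘ Δ` with `f` the entry `01` of `triRep p z`. -/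
theorem tailL_shAct (p : ι → ι → 𝕜ˣ) (z : ι) (a : GX p) (w : Sh p) :
    tailL p z (shAct p a w) = shAct p (hit p (triEntry p z 0 1) a) w
      + shAct p (hit p (triEntry p z 0 0) a) (tailL p z w) := by
  induction a using induct generalizing w with
  | hx i =>
    have h1 : shAct p (xOf p i) = LinearMap.mulLeft 𝕜 (tens p [i]) := by simp [shAct]
    rw [h1, LinearMap.mulLeft_apply, tailL_letter_mul, hit_x, hit_x, triEntry_apply, triEntry_apply,
      triEntry_apply, triEntry_apply, triRep_x, triRep_grp, map_add, map_smul, map_smul, h1,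
      map_add, map_smul, map_smul, h1]
    have h2 : chi p z (gGen p i) = p z i := rfl
    split_ifs <;> simp [h2]
  | hg g =>
    have h1 : shAct p (grpOf p g) = diagAct p g := by simp [shAct]
    rw [hit_grp, hit_grp, triEntry_apply, triEntry_apply, triRep_grp, map_smul, map_smul, h1,
      tailL_diagAct]
    simp
  | hc c =>
    rw [hit_algebraMap, hit_algebraMap, triEntry_apply, triEntry_apply]
    simp [Algebra.algebraMap_eq_smul_one]
  | hadd a b ha hb => simp only [map_add, LinearMap.add_apply, ha, hb]; abel
  | hmul a b ha hb =>
    rw [hit_mul p _ _ _ _ (triEntry_zero_one_mul p z), hit_diag_mul, hit_triEntry_one_one]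
    simp only [map_mul, map_add, LinearMap.add_apply, Module.End.mul_apply, ha, hb]
    abel

/-- The coefficient of a tensor. -/
noncomputable def coeffL (p : ι → ι → 𝕜ˣ) (u : List ι) : Sh p →ₗ[𝕜] 𝕜 :=
  ofTens p fun v => if v = u then 1 else 0

theorem eq_zero_of_coeffL (p : ι → ι → 𝕜ˣ) (a : Sh p) (h : ∀ u, coeffL p u a = 0) : a = 0 := by
  refine Finsupp.ext fun u => Eq.trans ?_ (h u)
  refine congrArg (fun f : Sh p →ₗ[𝕜] 𝕜 => f a)
    (Sh_lin_ext (p := p) (f := Finsupp.lapply u) fun v => ?_)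
  rw [coeffL, ofTens_tens]
  exact Finsupp.single_apply

theorem coeffL_nil_consL (p : ι → ι → 𝕜ˣ) (x : ι) (a : Sh p) : coeffL p [] (consL p x a) = 0 := by
  have : coeffL p [] ∘ₗ consL p x = 0 := Sh_lin_ext fun u => by simp [coeffL, consL_tens]
  exact congrArg (fun f => f a) this

theorem coeffL_cons (p : ι → ι → 𝕜ˣ) (z : ι) (u : List ι) (a : Sh p) :
    coeffL p (z :: u) a = coeffL p u (tailL p z a) := by
  have : coeffL p (z :: u) = coeffL p u ∘ₗ tailL p z := by
    refine Sh_lin_ext fun v => ?_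
    cases v with
    | nil => simp [coeffL, tailL_nil]
    | cons x v =>
      rw [LinearMap.comp_apply, ← consL_tens, tailL_consL, consL_tens]
      by_cases h : x = z <;> simp [coeffL, h]
  exact congrArg (fun f => f a) this

/-- The coefficient of the empty word is multiplied by the counit. -/
theorem coeffL_nil_shAct (p : ι → ι → 𝕜ˣ) (a : GX p) (w : Sh p) :
    coeffL p [] (shAct p a w) = counitGX p a * coeffL p [] w := by
  suffices h : coeffL p [] ∘ₗ shAct p a = counitGX p a • coeffL p [] from
    congrArg (fun f => f w) h
  induction a using induct with
  | hx i =>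
    refine Sh_lin_ext fun u => ?_
    have h1 : shAct p (xOf p i) = LinearMap.mulLeft 𝕜 (tens p [i]) := by simp [shAct]
    have h2 : counitGX p (xOf p i) = 0 := by simp [counitGX]
    rw [h1, h2, zero_smul, LinearMap.comp_apply, LinearMap.mulLeft_apply]
    cases u with
    | nil => simp [tens_nil, ← consL_tens, coeffL_nil_consL]
    | cons y u => simp [tens_cons_mul_cons, coeffL_nil_consL]
  | hg g =>
    refine Sh_lin_ext fun u => ?_
    have h1 : shAct p (grpOf p g) = diagAct p g := by simp [shAct]
    have h2 : counitGX p (grpOf p g) = 1 := by simp [counitGX]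
    rw [h1, h2, one_smul, LinearMap.comp_apply, diagAct_tens]
    cases u with
    | nil => simp
    | cons x u => simp [coeffL]
  | hc c => ext w; simp [Algebra.algebraMap_eq_smul_one]
  | hadd a b ha hb => rw [map_add, map_add, LinearMap.comp_add, ha, hb, add_smul]
  | hmul a b ha hb =>
    rw [map_mul, map_mul, Module.End.mul_eq_comp, ← LinearMap.comp_assoc, ha,
      LinearMap.smul_comp, hb, smul_smul]

/-- A coideal in the ideal generated by the `x_i x_j` annihilates the unit of the shuffle algebra:
the coefficients of `a · 1` are values of iterated skew derivations of `a`, and the coideal is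
stable under these. -/
theorem shAct_eq_zero_of_mem_coideal (p : ι → ι → 𝕜ˣ) (I : Submodule 𝕜 (GX p)) [I.IsCoideal]
    (hI : ∀ a ∈ I, a ∈ ideal2 p) {a : GX p} (ha : a ∈ I) : shAct p a 1 = 0 := by
  have key : ∀ (u : List ι) (a : GX p), a ∈ I → coeffL p u (shAct p a 1) = 0 := by
    intro u
    induction u with
    | nil =>
      intro a ha
      have h := Submodule.IsCoideal.counit_eq_zero (I := I) ha
      rw [counit_eq] at h
      rw [coeffL_nil_shAct, h, zero_mul]
    | cons z u ih =>
      intro a ha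
      rw [coeffL_cons, tailL_shAct, ← tens_nil, tailL_nil, map_zero, add_zero]
      refine ih _ (hit_mem p _ I (fun b hb => ?_) ha)
      rw [triEntry_apply, triRep_eq_zero p z (hI b hb), Matrix.zero_apply]
  exact eq_zero_of_coeffL p _ fun u => key u a ha

end HopfIdeal

/-- Of the properties of `Λ` only two matter: it is a coideal, and it lies in the ideal generated by
the `x_i x_j`. -/
theorem shAct_eq_zero_of_mem_lam (p : ι → ι → 𝕜ˣ) {a : GX p} (ha : a ∈ lam p) :
    shAct p a 1 = 0 := by
  classical
  have := (lam_isHopfIdeal p).toIsCoideal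
  exact shAct_eq_zero_of_mem_coideal p ((lam p).restrictScalars 𝕜) (fun b hb => lam_le p hb) ha

end Representation

/-! ### The words `u(k, m)` and their bracketings -/

section Words

variable {𝕜 : Type*} [Field 𝕜] {n : ℕ} [NeZero n]

theorem idx_psi {i j : ℕ} (hi : 1 ≤ i) (hj : 1 ≤ j) (h : i + j = 2 * n + 1) :
    idx n i = idx n j := by
  rw [idx, idx]
  congr 1
  split_ifs <;> omega

theorem wd_eq_nil {k m : ℕ} (h : m < k) : wd n k m = [] := by
  simp [wd, Nat.sub_eq_zero_of_le h]

theorem wd_cons {k m : ℕ} (h : k ≤ m) : wd n k m = idx n k :: wd n (k + 1) m := by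
  rw [wd, wd, show m + 1 - k = (m + 1 - (k + 1)) + 1 by omega, List.range'_succ, List.map_cons]

theorem wd_self (k : ℕ) : wd n k k = [idx n k] := by
  rw [wd_cons le_rfl, wd_eq_nil (Nat.lt_succ_self k)]

theorem wd_succ {k m : ℕ} (h : k ≤ m + 1) : wd n k (m + 1) = wd n k m ++ [idx n (m + 1)] := by
  rw [wd, wd, show m + 1 + 1 - k = (m + 1 - k) + 1 by omega, List.range'_concat, List.map_append]
  simp [show k + (m + 1 - k) = m + 1 by omega]

theorem wd_append {k j m : ℕ} (h : k ≤ j + 1) (hj : j ≤ m) :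
    wd n k m = wd n k j ++ wd n (j + 1) m := by
  induction m, hj using Nat.le_induction with
  | base => simp [wd_eq_nil]
  | succ m hm ih => rw [wd_succ (by omega), ih, wd_succ (by omega), List.append_assoc]

theorem mem_wd {k m : ℕ} {x : Fin n} (h : x ∈ wd n k m) : ∃ i, k ≤ i ∧ i ≤ m ∧ idx n i = x := by
  simp only [wd, List.mem_map, List.mem_range'_1] at h
  obtain ⟨i, hi, rfl⟩ := h
  exact ⟨i, hi.1, by omega, rfl⟩

theorem mem_wdRev {k m : ℕ} {x : Fin n} (h : x ∈ wdRev n m k) :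
    ∃ i, k ≤ i ∧ i ≤ m ∧ idx n i = x := mem_wd (List.mem_reverse.1 h)

theorem wdRev_perm (k m : ℕ) : (wd n k m).Perm (wdRev n m k) := (List.reverse_perm _).symm

theorem wdRev_eq_nil {k m : ℕ} (h : m < k) : wdRev n m k = [] := by
  rw [wdRev, wd_eq_nil h, List.reverse_nil]

theorem wdRev_self (k : ℕ) : wdRev n k k = [idx n k] := by
  rw [wdRev, wd_self, List.reverse_singleton]

theorem wdRev_succ {k m : ℕ} (h : k ≤ m + 1) :
    wdRev n (m + 1) k = idx n (m + 1) :: wdRev n m k := by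
  rw [wdRev, wd_succ h, List.reverse_append]
  rfl

/-- The word `x_m ⋯ x_{n+1}` with `m = ψ(k)` is `x_k ⋯ x_n`. -/
theorem wdRev_psi {k : ℕ} (hk : 1 ≤ k) (hkn : k ≤ n) :
    wdRev n (psi n k) (n + 1) = wd n k n := by
  induction hkn using Nat.decreasingInduction with
  | self =>
    rw [show psi n n = n + 1 by unfold psi; omega, wdRev_self, wd_self,
      idx_psi (i := n + 1) (j := n) (by omega) hk (by omega)]
  | of_succ k hkn ih =>
    rw [show psi n k = psi n (k + 1) + 1 by unfold psi; omega, wdRev_succ (by unfold psi; omega),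
      ih (by omega), wd_cons hkn.le,
      idx_psi (i := psi n (k + 1) + 1) (j := k) (by omega) hk (by unfold psi; omega)]

theorem wdRev_append {k j m : ℕ} (h : k ≤ j + 1) (hj : j ≤ m) :
    wdRev n m k = wdRev n m (j + 1) ++ wdRev n j k := by
  rw [wdRev, wd_append h hj, List.reverse_append]
  rfl

theorem isHomog_xv (i : ℕ) : IsHomog (𝕜 := 𝕜) [idx n i] (xv 𝕜 n i) := isHomog_letter _

theorem isHomog_leftBr (p : Fin n → Fin n → 𝕜ˣ) (k d : ℕ) :
    IsHomog (wd n k (k + d)) (leftBr p k d) := by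
  induction d with
  | zero => rw [add_zero, wd_self]; exact isHomog_xv k
  | succ d ih =>
    rw [← add_assoc, wd_succ (by omega)]
    exact ih.br p (isHomog_xv _)

theorem isHomog_rightBr (p : Fin n → Fin n → 𝕜ˣ) (k d : ℕ) :
    IsHomog (wd n k (k + d)) (rightBr p k d) := by
  induction d generalizing k with
  | zero => rw [add_zero, wd_self]; exact isHomog_xv k
  | succ d ih =>
    rw [wd_cons (by omega), show k + (d + 1) = k + 1 + d by omega]
    exact (isHomog_xv k).br p (ih (k + 1))

theorem shHom_xv (p : Fin n → Fin n → 𝕜ˣ) (i : ℕ) :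
    shHom p (xv 𝕜 n i) = (1 : 𝕜) • tens p [idx n i] := by
  rw [xv, shHom_letter, one_smul]

end Words

/-! ### A letter and its neighbours in the Dynkin diagram -/

section Local

variable {𝕜 ι : Type*} [Field 𝕜] {p : ι → ι → 𝕜ˣ} {q : 𝕜ˣ} {x y : ι}

theorem cw_comm (p : ι → ι → 𝕜ˣ) (x y : ι) : cw p x [y] = cw p y [x] := by
  rw [cw_singleton, cw_singleton, mul_comm]

/-- A letter `x` and a word whose only letter not orthogonal to `x` is its first letter, a
neighbour of `x`. -/
theorem skew_adjacent_cons {w : List ι} (hy : cw p x [y] = (q ^ 2)⁻¹)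
    (hw : ∀ z ∈ w, cw p x [z] = 1) : skew p 1 (y :: w) [x]
      = ((((pw p [x] (y :: w))⁻¹ : 𝕜ˣ) : 𝕜) * (1 - ((q : 𝕜) ^ 2)⁻¹)) • tens p (x :: y :: w) := by
  rw [skew_cons_letter, skew_eq_zero_of_orthogonal p w [x] fun z hz t ht => by
    rw [List.mem_singleton.1 ht]; exact hw z hz, map_zero, zero_add, cw_cons, hy,
    cw_eq_one p x w hw]
  simp

/-- The coefficient of `skew_adjacent_cons` in terms of `p(w, x)`. -/
theorem skew_adjacent_cons' {w : List ι} (hy : cw p x [y] = (q ^ 2)⁻¹)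
    (hw : ∀ z ∈ w, cw p x [z] = 1) : skew p 1 (y :: w) [x]
      = ((pw p (y :: w) [x] : 𝕜) * ((q : 𝕜) ^ 2 - 1)) • tens p (x :: y :: w) := by
  rw [skew_adjacent_cons hy hw, inv_pw_left, cw_cons, hy, cw_eq_one p x w hw]
  congr 1
  have := q.ne_zero
  push_cast
  field_simp

/-- The two nonzero terms are insertions of `x` before and after the first letter `x`: they give the
same tensor, with opposite coefficients. -/
theorem skew_self_adjacent_cons {w : List ι} (hx : p x x = q ^ 2) (hy : cw p x [y] = (q ^ 2)⁻¹)
    (hw : ∀ z ∈ w, cw p x [z] = 1) : skew p 1 (x :: y :: w) [x] = 0 := by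
  have hc : cw p x (x :: y :: w) = q ^ 2 := by
    rw [cw_cons, cw_cons p x y, hy, cw_eq_one p x w hw, cw_singleton, hx]
    group
  rw [skew_cons_letter, skew_adjacent_cons hy hw, map_smul, consL_tens, ← add_smul, hc,
    pw_cons p x x, hx]
  convert zero_smul 𝕜 _ using 2
  have := q.ne_zero
  push_cast
  field_simp
  ring

/-- A further first letter, up to which the symmetric factors cancel, is passed without change. -/
theorem skew_cons_eq_zero {w : List ι} (hc : cw p x (y :: w) = 1) (hw : skew p 1 w [x] = 0) :
    skew p 1 (y :: w) [x] = 0 := by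
  rw [skew_cons_letter, hw, hc]
  simp

/-- Removing from the right hand word a first letter orthogonal to `x`. -/
theorem skew_letter_cons_of_orthogonal {w v : List ι} {c : 𝕜} (hy : cw p x [y] = 1)
    (hw : skew p 1 [x] w = (c * (pw p [x] w : 𝕜)) • tens p v) :
    skew p 1 [x] (y :: w) = (c * (pw p [x] (y :: w) : 𝕜)) • tens p (y :: v) := by
  have h1 : cw p y [x] = 1 := by rw [cw_comm, hy]
  have h2 : (p y x)⁻¹ = p x y := by rw [inv_eq_iff_mul_eq_one, ← cw_singleton, h1]
  rw [skew_letter_cons, h1, Units.val_one, mul_one, hw, h2, map_smul, consL_tens, smul_smul,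
    pw_cons]
  simp only [sub_self, zero_smul, zero_add]
  congr 1
  push_cast
  ring

/-- Skew commutation with two words passes to their skew commutator. -/
theorem skew_eq_zero_of_skew_eq_smul {u v v' w : List ι} {c : 𝕜} (hc : c ≠ 0)
    (hv : skew p 1 u v = 0) (hv' : skew p 1 u v' = 0) (h : skew p 1 v v' = c • tens p w)
    (hw : w.Perm (v ++ v')) : skew p 1 u w = 0 := by
  rw [skew_eq_zero_iff] at hv hv' ⊢
  have hu : pw p u w = pw p u v * pw p u v' := by
    rw [pw_perm p (List.Perm.refl u) hw, pw_append_right]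
  have key : tens p u * skew p 1 v v' = (pw p u w : 𝕜) • (skew p 1 v v' * tens p u) := by
    have h1 : tens p u * (tens p v * tens p v')
        = (pw p u w : 𝕜) • (tens p v * tens p v' * tens p u) := by
      rw [← mul_assoc, hv, smul_mul_assoc, mul_assoc, hv', mul_smul_comm, smul_smul, hu,
        Units.val_mul, mul_assoc]
    have h2 : tens p u * (tens p v' * tens p v)
        = (pw p u w : 𝕜) • (tens p v' * tens p v * tens p u) := by
      rw [← mul_assoc, hv', smul_mul_assoc, mul_assoc, hv, mul_smul_comm, smul_smul, hu,
        Units.val_mul, mul_assoc, mul_comm (pw p u v : 𝕜)]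
    rw [skew, mul_sub, sub_mul, mul_smul_comm, smul_mul_assoc, h1, h2, smul_sub, smul_comm]
  rw [h, mul_smul_comm, smul_mul_assoc, smul_comm] at key
  exact smul_right_injective _ hc key

theorem skew_of_skew_one_eq_zero {u v : List ι} (h : skew p 1 u v = 0) (r : 𝕜) :
    skew p r u v = (1 - r) • (tens p u * tens p v) := by
  rw [skew_eq_zero_iff] at h
  rw [skew, h, smul_smul, ← sub_smul]
  congr 1
  ring

end Local

/-! ### Symmetric factors of type `B_n` -/

section TypeBFactors

variable {𝕜 : Type*} [Field 𝕜] {n : ℕ} [NeZero n] {q : 𝕜ˣ} {p : Fin n → Fin n → 𝕜ˣ}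

theorem IsTypeB.p_self (hp : IsTypeB q p) {i : ℕ} (h1 : 1 ≤ i) (h2 : i < n) :
    p (idx n i) (idx n i) = q ^ 2 := hp.diag i h1 h2

theorem IsTypeB.cw_adj (hp : IsTypeB q p) {i : ℕ} (h1 : 1 ≤ i) (h2 : i < n) :
    cw p (idx n i) [idx n (i + 1)] = (q ^ 2)⁻¹ := by
  rw [cw_singleton]; exact hp.adj i h1 h2

theorem IsTypeB.cw_adj' (hp : IsTypeB q p) {i : ℕ} (h1 : 1 ≤ i) (h2 : i < n) :
    cw p (idx n (i + 1)) [idx n i] = (q ^ 2)⁻¹ := by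
  rw [cw_comm, hp.cw_adj h1 h2]

theorem IsTypeB.cw_diag (hp : IsTypeB q p) {i : ℕ} (h1 : 1 ≤ i) (h2 : i < n) :
    cw p (idx n i) [idx n i] = q ^ 4 := by
  rw [cw_singleton, hp.p_self h1 h2]; group

theorem IsTypeB.cw_last (hp : IsTypeB q p) : cw p (idx n n) [idx n n] = q ^ 2 := by
  have h : p (idx n n) (idx n n) = q := hp.last
  rw [cw_singleton, h, sq]

/-- Letters with positions at distance at least two in the Dynkin diagram are orthogonal. -/
theorem IsTypeB.cw_orth (hp : IsTypeB q p) {s j : ℕ} (hs : 1 ≤ s) (hsn : s ≤ n) (hj : 1 ≤ j)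
    (hjn : j ≤ 2 * n) (h1 : j + 1 < s ∨ s + 1 < j)
    (h2 : 2 * n + 1 - j + 1 < s ∨ s + 1 < 2 * n + 1 - j) : cw p (idx n s) [idx n j] = 1 := by
  have key : ∀ j, 1 ≤ j → j ≤ n → (j + 1 < s ∨ s + 1 < j) → cw p (idx n s) [idx n j] = 1 := by
    intro j hj hjn h
    rcases h with h | h
    · rw [cw_comm, cw_singleton]; exact hp.far j s hj h hsn
    · rw [cw_singleton]; exact hp.far s j hs h hjn
  by_cases h : j ≤ n
  · exact key j hj h h1
  · rw [idx_psi (i := j) (j := 2 * n + 1 - j) hj (by omega) (by omega)]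
    exact key _ (by omega) (by omega) h2

end TypeBFactors

/-! ### Brackets of a word with a letter -/

section RootVectors

variable {𝕜 : Type*} [Field 𝕜] {n : ℕ} [NeZero n] {q : 𝕜ˣ} {p : Fin n → Fin n → 𝕜ˣ}

theorem IsTypeB.orth_wdRev (hp : IsTypeB q p) {s k m : ℕ} (hs : 1 ≤ s) (hsn : s ≤ n) (hk : 1 ≤ k)
    (hm : m ≤ 2 * n) (h : ∀ j, k ≤ j → j ≤ m → (j + 1 < s ∨ s + 1 < j) ∧
      (2 * n + 1 - j + 1 < s ∨ s + 1 < 2 * n + 1 - j)) :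
    ∀ z ∈ wdRev n m k, cw p (idx n s) [z] = 1 := by
  intro z hz
  obtain ⟨j, hj1, hj2, rfl⟩ := mem_wdRev hz
  exact hp.cw_orth hs hsn (by omega) (by omega) (h j hj1 hj2).1 (h j hj1 hj2).2

theorem IsTypeB.orth_wd (hp : IsTypeB q p) {s k m : ℕ} (hs : 1 ≤ s) (hsn : s ≤ n) (hk : 1 ≤ k)
    (hm : m ≤ 2 * n) (h : ∀ j, k ≤ j → j ≤ m → (j + 1 < s ∨ s + 1 < j) ∧
      (2 * n + 1 - j + 1 < s ∨ s + 1 < 2 * n + 1 - j)) :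
    ∀ z ∈ wd n k m, cw p (idx n s) [z] = 1 := fun z hz =>
  hp.orth_wdRev hs hsn hk hm h z (List.mem_reverse.2 hz)

/-- For `s = r + 2` and `s < j < ψ(s) - 1` the word `x_j ⋯ x_k` skew commutes with `x_s`. -/
theorem IsTypeB.skew_wdRev_letter_mid (hp : IsTypeB q p) {k r : ℕ} (hk : 1 ≤ k) (hkr : k ≤ r + 1)
    (hr : r + 2 < n) {j : ℕ} (hj : r + 3 ≤ j) (hj2 : j ≤ 2 * n - r - 3) :
    cw p (idx n (r + 2)) (wdRev n j k) = 1 ∧ skew p 1 (wdRev n j k) [idx n (r + 2)] = 0 := by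
  have hw := hp.orth_wdRev (s := r + 2) (k := k) (m := r) (by omega) (by omega) hk (by omega)
    fun j _ _ => by omega
  have hx : p (idx n (r + 2)) (idx n (r + 2)) = q ^ 2 := hp.diag _ (by omega) (by omega)
  have ha : cw p (idx n (r + 2)) [idx n (r + 1)] = (q ^ 2)⁻¹ := hp.cw_adj' (by omega) (by omega)
  induction j, hj using Nat.le_induction with
  | base =>
    have hc : cw p (idx n (r + 2)) (wdRev n (r + 3) k) = 1 := by
      rw [wdRev_succ (by omega), wdRev_succ (by omega), wdRev_succ (by omega), cw_cons,
        cw_cons p _ (idx n (r + 2)), cw_cons p _ (idx n (r + 1)), ha, cw_eq_one p _ _ hw,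
        hp.cw_adj (by omega) (by omega), hp.cw_diag (by omega) (by omega)]
      group
    refine ⟨hc, ?_⟩
    rw [wdRev_succ (by omega)] at hc ⊢
    refine skew_cons_eq_zero hc ?_
    rw [wdRev_succ (by omega), wdRev_succ (by omega)]
    exact skew_self_adjacent_cons hx ha hw
  | succ j hj ih =>
    obtain ⟨ih1, ih2⟩ := ih (by omega)
    have hc : cw p (idx n (r + 2)) (wdRev n (j + 1) k) = 1 := by
      rw [wdRev_succ (by omega), cw_cons, ih1, hp.cw_orth (by omega) (by omega) (by omega)
        (by omega) (by omega) (by omega), one_mul]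
    refine ⟨hc, ?_⟩
    rw [wdRev_succ (by omega)] at hc ⊢
    exact skew_cons_eq_zero hc ih2

/-- Bracketing with a further letter on the right, below the reflected position. -/
theorem IsTypeB.skew_wdRev_letter (hp : IsTypeB q p) {k m : ℕ} (hk : 1 ≤ k) (hkm : k ≤ m)
    (hm : m + 1 < psi n k) : skew p 1 (wdRev n m k) [idx n (m + 1)]
      = ((if m = n then (q : 𝕜)⁻¹ else 1) * ((pw p (wdRev n m k) [idx n (m + 1)] : 𝕜) *
        ((q : 𝕜) ^ 2 - 1))) • tens p (wdRev n (m + 1) k) := by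
  have hq := q.ne_zero
  unfold psi at hm
  rcases lt_trichotomy m n with hmn | rfl | hmn
  -- `m < n`: only the first letter `x_m` of the word is not orthogonal to `x_{m+1}`.
  · obtain ⟨r, rfl⟩ : ∃ r, m = r + 1 := ⟨m - 1, by omega⟩
    rw [if_neg hmn.ne, one_mul, wdRev_succ (m := r + 1) (by omega), wdRev_succ (by omega)]
    exact skew_adjacent_cons' (hp.cw_adj' (by omega) (by omega))
      (hp.orth_wdRev (by omega) (by omega) hk (by omega) fun j _ _ => by omega)
  -- `m = n`: both the letter and the first letter of the word are `x_n`, and the symmetric factor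
  -- of `x_n` with the whole word is `q² q⁻² = 1`, so that only the insertion
  -- before `x_{n-1}` is left.
  · obtain ⟨r, rfl⟩ : ∃ r, m = r + 2 := ⟨m - 2, by omega⟩
    have hw := hp.orth_wdRev (s := r + 2) (k := k) (m := r) (by omega) (by omega) hk (by omega)
      fun j _ _ => by omega
    have ha : cw p (idx (r + 2) (r + 2)) [idx (r + 2) (r + 1)] = (q ^ 2)⁻¹ :=
      hp.cw_adj' (by omega) (by omega)
    have hx : p (idx (r + 2) (r + 2)) (idx (r + 2) (r + 2)) = q := hp.last
    have hi : idx (r + 2) (r + 2 + 1) = idx (r + 2) (r + 2) :=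
      idx_psi (by omega) (by omega) (by omega)
    have hc : cw p (idx (r + 2) (r + 2)) (wdRev (r + 2) (r + 1) k) = (q ^ 2)⁻¹ := by
      rw [wdRev_succ (by omega), cw_cons, ha, cw_eq_one p _ _ hw, mul_one]
    have h1 : skew p 1 (wdRev (r + 2) (r + 1) k) [idx (r + 2) (r + 2)]
        = ((pw p (wdRev (r + 2) (r + 1) k) [idx (r + 2) (r + 2)] : 𝕜) * ((q : 𝕜) ^ 2 - 1)) •
          tens p (idx (r + 2) (r + 2) :: wdRev (r + 2) (r + 1) k) := by
      rw [wdRev_succ (by omega)]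
      exact skew_adjacent_cons' ha hw
    rw [if_pos rfl, wdRev_succ (m := r + 2) (by omega), wdRev_succ (m := r + 1) (by omega), hi,
      skew_cons_letter, h1, map_smul, consL_tens, cw_cons, hc, hp.cw_last,
      mul_inv_cancel]
    simp only [Units.val_one, mul_one, sub_self, mul_zero, zero_smul, add_zero]
    congr 1
    have h2 : pw p (idx (r + 2) (r + 1 + 1) :: wdRev (r + 2) (r + 1) k) [idx (r + 2) (r + 2)]
        = q * pw p (wdRev (r + 2) (r + 1) k) [idx (r + 2) (r + 2)] := by
      rw [pw_cons_left]
      congr 1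
      simp [pw, hx]
    rw [h2]
    push_cast
    field_simp
  -- `m > n`: the letter is `x_s`, `s = r + 2 = ψ(m + 1)`, and the first letter of the word is
  -- `x_{s+1}`; only the insertion before it contributes.
  · obtain ⟨r, hr⟩ : ∃ r, m = 2 * n - r - 2 := ⟨2 * n - m - 2, by omega⟩
    have hi : idx n (m + 1) = idx n (r + 2) := idx_psi (by omega) (by omega) (by omega)
    obtain ⟨hc, h0⟩ := hp.skew_wdRev_letter_mid (k := k) (r := r) (j := m - 1) hk (by omega)
      (by omega) (by omega) (by omega)
    obtain ⟨j, rfl⟩ : ∃ j, m = j + 1 := ⟨m - 1, by omega⟩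
    rw [Nat.add_sub_cancel] at hc h0
    have ha : cw p (idx n (r + 2)) [idx n (j + 1)] = (q ^ 2)⁻¹ := by
      rw [idx_psi (i := j + 1) (j := r + 3) (by omega) (by omega) (by omega)]
      exact hp.cw_adj (by omega) (by omega)
    rw [if_neg hmn.ne', one_mul, wdRev_succ (m := j + 1) (by omega), wdRev_succ (m := j) (by omega),
      hi, skew_cons_letter, h0, map_zero, zero_add, inv_pw_left, cw_cons, hc, ha]
    congr 1
    push_cast
    field_simp

/-- Passing letters orthogonal to `x_k`, in the bracket of `x_k` with a word. -/
theorem skew_letter_wdRev_chain {k i j : ℕ} {e : 𝕜} (hki : k ≤ i) (hij : i ≤ j)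
    (h : skew p 1 [idx n k] (wdRev n i (k + 1))
      = (e * (pw p [idx n k] (wdRev n i (k + 1)) : 𝕜)) • tens p (wdRev n i k))
    (ho : ∀ t, i < t → t ≤ j → cw p (idx n k) [idx n t] = 1) :
    skew p 1 [idx n k] (wdRev n j (k + 1))
      = (e * (pw p [idx n k] (wdRev n j (k + 1)) : 𝕜)) • tens p (wdRev n j k) := by
  induction j, hij using Nat.le_induction with
  | base => exact h
  | succ j hij ih =>
    rw [wdRev_succ (by omega), wdRev_succ (by omega)]
    exact skew_letter_cons_of_orthogonal (ho _ (by omega) le_rfl)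
      (ih fun t h1 h2 => ho t h1 (by omega))

/-- The bracket of two neighbouring letters. -/
theorem skew_letter_adjacent {ι : Type*} {p : ι → ι → 𝕜ˣ} {x y : ι}
    (h : cw p x [y] = (q ^ 2)⁻¹) :
    skew p 1 [x] [y] = (((q : 𝕜) ^ 2 - 1) * (pw p [x] [y] : 𝕜)) • tens p [y, x] := by
  have h1 : (p y x)⁻¹ = q ^ 2 * p x y := by
    rw [cw_singleton] at h
    rw [inv_eq_iff_mul_eq_one, mul_left_comm, mul_comm (p y x), h, mul_inv_cancel]
  rw [skew_letter_cons, skew_nil_right, cw_comm, h, h1, map_smul, consL_tens, smul_smul]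
  simp only [sub_self, zero_smul, zero_add]
  congr 1
  have := q.ne_zero
  simp only [pw, List.map_cons, List.map_nil, List.prod_cons, List.prod_nil]
  push_cast
  field_simp

/-- The skew commutator of `x_k` with the word `x_{ψ(k)} ⋯ x_{k+1}` for the parameter `q⁻²`,
which is the one that occurs when a first letter `x_{ψ(k)+1} = x_{k-1}` has been removed. -/
theorem IsTypeB.skew_letter_wdRev_psi (hp : IsTypeB q p) {k : ℕ} (hk : 1 ≤ k) (hkn : k ≤ n) :
    skew p ((q : 𝕜) ^ 2)⁻¹ [idx n k] (wdRev n (psi n k) (k + 1))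
      = ((if k = n then (q : 𝕜)⁻¹ else 1) * (1 - ((q : 𝕜) ^ 2)⁻¹) *
        (pw p [idx n k] (wdRev n (psi n k) (k + 1)) : 𝕜)) • tens p (wdRev n (psi n k) k) := by
  have hq := q.ne_zero
  rcases hkn.eq_or_lt with rfl | hkn
  · have hx : p (idx k k) (idx k k) = q := hp.last
    have hi : idx k (k + 1) = idx k k := idx_psi (by omega) (by omega) (by omega)
    have hpsi : psi k k = k + 1 := by unfold psi; omega
    rw [hpsi, wdRev_succ (m := k) (k := k) (by omega), wdRev_self, wdRev_self, hi, if_pos rfl,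
      skew_letter_cons, skew_nil_right, hp.cw_last, map_smul, consL_tens, hx, smul_smul, ← add_smul]
    congr 1
    simp only [pw, List.map_cons, List.map_nil, List.prod_cons, List.prod_nil, hx]
    push_cast
    field_simp
    ring
  · have hx : p (idx n k) (idx n k) = q ^ 2 := hp.diag k hk hkn
    have ha : cw p (idx n k) [idx n (k + 1)] = (q ^ 2)⁻¹ := hp.cw_adj hk hkn
    -- The bracket with the word from `k + 1` to `ψ(k) - 2`.
    have h0 := skew_letter_wdRev_chain (n := n) (p := p) (k := k) (i := k + 1) (j := 2 * n - k - 1)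
      (e := (q : 𝕜) ^ 2 - 1) (by omega) (by omega)
      (by
        rw [wdRev_succ (m := k) (k := k) (by omega), wdRev_self, wdRev_self]
        exact skew_letter_adjacent ha)
      (fun t h1 h2 => hp.cw_orth hk hkn.le (by omega) (by omega) (by omega) (by omega))
    obtain ⟨j, hj⟩ : ∃ j, j = 2 * n - k - 1 := ⟨_, rfl⟩
    have hpsi : psi n k = j + 1 + 1 := by unfold psi; omega
    have hi1 : idx n (j + 1) = idx n (k + 1) := idx_psi (by omega) (by omega) (by omega)
    have hi2 : idx n (j + 1 + 1) = idx n k := idx_psi (by omega) (by omega) (by omega)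
    have hb : (p (idx n (k + 1)) (idx n k))⁻¹ = q ^ 2 * p (idx n k) (idx n (k + 1)) := by
      rw [cw_singleton] at ha
      rw [inv_eq_iff_mul_eq_one, mul_left_comm, mul_comm (p (idx n (k + 1)) _), ha, mul_inv_cancel]
    rw [← hj] at h0
    rw [hpsi, wdRev_succ (m := j + 1) (by omega), wdRev_succ (m := j) (by omega),
      wdRev_succ (m := j + 1) (by omega), wdRev_succ (m := j) (by omega), hi1, hi2, if_neg hkn.ne,
      skew_letter_cons, skew_letter_cons, hp.cw_diag hk hkn, cw_comm, ha, hx, hb]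
    have hr : ((q : 𝕜) ^ 2)⁻¹ * ((q ^ 4 : 𝕜ˣ) : 𝕜) * (((q ^ 2)⁻¹ : 𝕜ˣ) : 𝕜) = 1 := by
      push_cast
      field_simp
    rw [hr, h0]
    simp only [map_add, map_smul, consL_tens, smul_add, smul_smul, pw_cons, hx]
    -- Insertions of `x_k` on the two sides of the letter `x_{ψ(k)} = x_k` cancel.
    rw [← add_assoc, ← add_smul]
    convert zero_add _ using 2
    · convert zero_smul 𝕜 _ using 2
      push_cast
      field_simp
      ring
    · push_cast
      field_simp

/-- Bracketing with a further letter on the left, above the reflected position. -/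
theorem IsTypeB.skew_letter_wdRev (hp : IsTypeB q p) {k m : ℕ} (hk : 1 ≤ k) (hkm : k < m)
    (hm : m ≤ 2 * n) (hpsi : psi n k < m) : skew p 1 [idx n k] (wdRev n m (k + 1))
      = ((if k = n then (q : 𝕜)⁻¹ else 1) * ((q : 𝕜) ^ 2 - 1) *
        (pw p [idx n k] (wdRev n m (k + 1)) : 𝕜)) • tens p (wdRev n m k) := by
  have hq := q.ne_zero
  by_cases hkn : k ≤ n
  -- The letter in position `ψ(k) + 1` is `x_{k-1}`, a neighbour of `x_k`; the letters in later
  -- positions are orthogonal to `x_k`.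
  · have h := hp.skew_letter_wdRev_psi hk hkn
    obtain ⟨j, hj⟩ : ∃ j, j = psi n k := ⟨_, rfl⟩
    rw [← hj] at h hpsi
    unfold psi at hj
    have hi : idx n (j + 1) = idx n (k - 1) := idx_psi (by omega) (by omega) (by omega)
    have ha : cw p (idx n k) [idx n (k - 1)] = (q ^ 2)⁻¹ := by
      have := hp.cw_adj' (i := k - 1) (by omega) (by omega)
      rwa [Nat.sub_add_cancel hk] at this
    have hb : (p (idx n (k - 1)) (idx n k))⁻¹ = q ^ 2 * p (idx n k) (idx n (k - 1)) := by
      rw [cw_singleton] at ha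
      rw [inv_eq_iff_mul_eq_one, mul_left_comm, mul_comm (p (idx n (k - 1)) _), ha, mul_inv_cancel]
    refine skew_letter_wdRev_chain (i := j + 1) (by omega) (by omega) ?_
      (fun t h1 h2 => hp.cw_orth hk hkn (by omega) (by omega) (by omega) (by omega))
    have hr : (1 : 𝕜) * (((q ^ 2)⁻¹ : 𝕜ˣ) : 𝕜) = ((q : 𝕜) ^ 2)⁻¹ := by push_cast; rw [one_mul]
    rw [wdRev_succ (by omega), wdRev_succ (by omega), hi, skew_letter_cons, cw_comm, ha, hb, hr, h,
      map_smul, consL_tens, smul_smul, pw_cons]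
    simp only [sub_self, zero_smul, zero_add]
    congr 1
    push_cast
    field_simp
  -- For `k > n` the last letter `x_{k+1}` of the word is a neighbour of `x_k`, and the others are
  -- orthogonal to it.
  · have hi : idx n k = idx n (2 * n + 1 - k) := idx_psi (by omega) (by omega) (by omega)
    rw [if_neg (by omega), one_mul]
    refine skew_letter_wdRev_chain (i := k + 1) (by omega) (by omega) ?_ fun t h1 h2 => ?_
    · rw [wdRev_succ (m := k) (k := k) (by omega), wdRev_self, wdRev_self]
      refine skew_letter_adjacent ?_
      have := hp.cw_adj' (i := 2 * n + 1 - (k + 1)) (by omega) (by omega)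
      rwa [show 2 * n + 1 - (k + 1) + 1 = 2 * n + 1 - k by omega, ← hi,
        idx_psi (i := 2 * n + 1 - (k + 1)) (j := k + 1) (by omega) (by omega) (by omega)] at this
    · rw [hi]
      exact hp.cw_orth (by omega) (by omega) (by omega) (by omega) (by omega) (by omega)

end RootVectors

/-! ### Brackets of a word with its reversal -/

section SymmetricWords

variable {𝕜 : Type*} [Field 𝕜] {n : ℕ} [NeZero n] {q : 𝕜ˣ} {p : Fin n → Fin n → 𝕜ˣ}

theorem IsTypeB.cw_wd_succ (hp : IsTypeB q p) {i : ℕ} (hi : 1 ≤ i) (hin : i < n) :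
    cw p (idx n i) (wd n (i + 1) n) = (q ^ 2)⁻¹ := by
  rw [wd_cons (by omega), cw_cons, hp.cw_adj hi hin, cw_eq_one p _ _
    (hp.orth_wd hi hin.le (by omega) (by omega) fun j _ _ => by omega), mul_one]

theorem IsTypeB.cw_wd_self (hp : IsTypeB q p) {i : ℕ} (hi : 1 ≤ i) (hin : i < n) :
    cw p (idx n i) (wd n i n) = q ^ 2 := by
  rw [wd_cons (by omega), cw_cons, hp.cw_wd_succ hi hin, hp.cw_diag hi hin]
  group

theorem IsTypeB.cw_last_wd (hp : IsTypeB q p) {i : ℕ} (hi : 1 ≤ i) (hin : i < n) :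
    cw p (idx n n) (wd n i n) = 1 := by
  obtain ⟨m, hm⟩ : ∃ m, n = m + 1 := ⟨n - 1, by omega⟩
  have h1 : cw p (idx n n) [idx n m] = (q ^ 2)⁻¹ := by
    have := hp.cw_adj' (i := m) (by omega) (by omega)
    rwa [← hm] at this
  rw [wd_append (n := n) (k := i) (j := m) (m := n) (by omega) (by omega), ← hm, wd_self, cw_append,
    hp.cw_last, cw_perm p _ (wdRev_perm i m)]
  obtain ⟨l, rfl⟩ : ∃ l, m = l + 1 := ⟨m - 1, by omega⟩
  rw [wdRev_succ (by omega), cw_cons, h1, cw_eq_one p _ _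
    (hp.orth_wdRev (by omega) le_rfl hi (by omega) fun j _ _ => by omega)]
  group

/-- The word `x_i ⋯ x_n` skew commutes with `x_i`. -/
theorem IsTypeB.skew_wd_first (hp : IsTypeB q p) {i : ℕ} (hi : 1 ≤ i) (hin : i < n) :
    skew p 1 (wd n i n) [idx n i] = 0 := by
  rw [wd_cons (by omega), wd_cons (by omega)]
  exact skew_self_adjacent_cons (hp.p_self hi hin) (hp.cw_adj hi hin)
    (hp.orth_wd hi hin.le (by omega) (by omega) fun j _ _ => by omega)

/-- The word `x_i ⋯ x_n` skew commutes with the `x_j`, `i < j < n`. -/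
theorem IsTypeB.skew_wd_inner (hp : IsTypeB q p) {i j : ℕ} (hi : 1 ≤ i) (hij : i < j)
    (hjn : j < n) : skew p 1 (wd n i n) [idx n j] = 0 ∧ cw p (idx n j) (wd n i n) = 1 := by
  obtain ⟨m, rfl⟩ : ∃ m, j = m + 1 := ⟨j - 1, by omega⟩
  have him : i ≤ m := by omega
  clear hij
  induction him using Nat.decreasingInduction with
  | self =>
    have hc : cw p (idx n (m + 1)) (wd n m n) = 1 := by
      rw [wd_cons (by omega), cw_cons, hp.cw_wd_self (by omega) hjn, hp.cw_adj' hi (by omega)]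
      group
    refine ⟨?_, hc⟩
    rw [wd_cons (by omega)] at hc ⊢
    exact skew_cons_eq_zero hc (hp.skew_wd_first (by omega) hjn)
  | of_succ i him ih =>
    obtain ⟨ih1, ih2⟩ := ih (by omega)
    have hc : cw p (idx n (m + 1)) (wd n i n) = 1 := by
      rw [wd_cons (by omega), cw_cons, ih2, hp.cw_orth (by omega) (by omega) (by omega) (by omega)
        (by omega) (by omega), one_mul]
    refine ⟨?_, hc⟩
    rw [wd_cons (by omega)] at hc ⊢
    exact skew_cons_eq_zero hc ih1

/-- The words `x_i ⋯ x_n` and `x_i ⋯ x_k`, `k ≤ i < n`, skew commute. -/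
theorem IsTypeB.skew_wd_wdRev_first (hp : IsTypeB q p) {k i : ℕ} (hk : 1 ≤ k) (hki : k ≤ i)
    (hin : i < n) : skew p 1 (wd n i n) (wdRev n i k) = 0 := by
  rcases hki.eq_or_lt with rfl | hki
  · rw [wdRev_self]; exact hp.skew_wd_first hk hin
  obtain ⟨l, rfl⟩ : ∃ l, i = l + 2 := ⟨i - 2, by omega⟩
  have hx : p (idx n (l + 2)) (idx n (l + 2)) = q ^ 2 := hp.diag _ (by omega) (by omega)
  -- Without their first letters, both equal to `x_i`, `i = l + 2`, the two words are orthogonal.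
  -- Expanding twice leaves two multiples of `x_i x_i` followed by the product of these, which
  -- cancel.
  have ho : ∀ i, l + 3 ≤ i → ∀ x ∈ wd n i n, ∀ y ∈ wdRev n (l + 1) k, cw p y [x] = 1 := by
    intro i hi x hx y hy
    obtain ⟨j, hj, hj', rfl⟩ := mem_wdRev hy
    exact hp.orth_wd (by omega) (by omega) (by omega) (by omega) (fun t _ _ => by omega) x hx
  have hAB : skew p 1 (wd n (l + 3) n) (wdRev n (l + 1) k) = 0 :=
    skew_eq_zero_of_orthogonal p _ _ (ho _ le_rfl)
  have h1 : skew p 1 (wd n (l + 3) n) (idx n (l + 2) :: wdRev n (l + 1) k)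
      = ((((pw p [idx n (l + 2)] (wd n (l + 3) n))⁻¹ : 𝕜ˣ) : 𝕜) * (1 - ((q : 𝕜) ^ 2)⁻¹)) •
        consL p (idx n (l + 2)) (tens p (wd n (l + 3) n) * tens p (wdRev n (l + 1) k)) := by
    have h0 : skew p 1 (wd n (l + 4) n) (idx n (l + 2) :: wdRev n (l + 1) k) = 0 := by
      refine skew_eq_zero_of_orthogonal p _ _ fun x hx y hy => ?_
      rcases List.mem_cons.1 hy with rfl | hy
      · exact hp.orth_wd (by omega) (by omega) (by omega) (by omega) (fun t _ _ => by omega) x hx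
      · exact ho _ (by omega) x hx y hy
    rw [wd_cons (k := l + 3) (by omega), skew_cons_cons, h0, ← wd_cons (by omega),
      hp.cw_wd_succ (by omega) hin, skew_of_skew_one_eq_zero hAB, map_zero, zero_add, map_smul,
      smul_smul]
    simp
  have h2 : skew p ((q : 𝕜) ^ 2) (wd n (l + 2) n) (wdRev n (l + 1) k)
      = (1 - (q : 𝕜) ^ 2) •
        consL p (idx n (l + 2)) (tens p (wd n (l + 3) n) * tens p (wdRev n (l + 1) k)) := by
    have h0 : skew p 1 (wd n (l + 2) n) (wdRev n l k) = 0 := by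
      refine skew_eq_zero_of_orthogonal p _ _ fun x hx y hy => ?_
      obtain ⟨j, hj, hj', rfl⟩ := mem_wdRev hy
      exact hp.orth_wd (by omega) (by omega) (by omega) (by omega) (fun t _ _ => by omega) x hx
    have hc : cw p (idx n (l + 1)) (wd n (l + 2) n) = (q ^ 2)⁻¹ :=
      hp.cw_wd_succ (by omega) (by omega)
    have hr : (q : 𝕜) ^ 2 * (((q ^ 2)⁻¹ : 𝕜ˣ) : 𝕜) = 1 := by
      have := q.ne_zero
      push_cast
      field_simp
    rw [wdRev_succ (m := l) (by omega), wd_cons (k := l + 2) (by omega), skew_cons_cons,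
      ← wd_cons (by omega), hc, hr, h0, ← wdRev_succ (by omega), skew_of_skew_one_eq_zero hAB]
    simp
  rw [wdRev_succ (m := l + 1) (by omega), wd_cons (by omega), skew_cons_cons, ← wd_cons (by omega),
    hp.cw_wd_self (by omega) hin, h1, one_mul, Units.val_pow_eq_pow_val, h2, map_smul, map_smul,
    smul_smul, ← add_smul, wd_cons (k := l + 2) (by omega), pw_cons, hx]
  convert zero_smul 𝕜 _ using 2
  have := q.ne_zero
  push_cast
  field_simp
  ring

/-- The words `x_i ⋯ x_n` and `x_j ⋯ x_k`, `k ≤ i ≤ j < n`, skew commute: the second one is a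
multiple of an iterated bracket of words that skew commute with the first one. -/
theorem IsTypeB.skew_wd_wdRev (hp : IsTypeB q p) (hq : (q : 𝕜) ^ 2 - 1 ≠ 0) {k i j : ℕ} (hk : 1 ≤ k)
    (hki : k ≤ i) (hij : i ≤ j) (hjn : j < n) : skew p 1 (wd n i n) (wdRev n j k) = 0 := by
  induction j, hij using Nat.le_induction with
  | base => exact hp.skew_wd_wdRev_first hk hki hjn
  | succ j hij ih =>
    have h := hp.skew_wdRev_letter (k := k) (m := j) hk (by omega) (by unfold psi; omega)
    rw [if_neg (by omega), one_mul] at h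
    refine skew_eq_zero_of_skew_eq_smul (mul_ne_zero (Units.ne_zero _) hq) (ih (by omega))
      (hp.skew_wd_inner (by omega) (by omega) hjn).1 h ?_
    rw [wdRev_succ (by omega)]
    exact List.perm_append_comm (l₁ := [_])

/-- The skew commutator of `x_i ⋯ x_n` and `x_n ⋯ x_k` is a multiple of a single tensor. -/
theorem IsTypeB.skew_wd_wdRev_last (hp : IsTypeB q p) (hq : (q : 𝕜) ^ 2 - 1 ≠ 0) {k i : ℕ}
    (hk : 1 ≤ k) (hki : k ≤ i) (hin : i ≤ n) : skew p 1 (wd n i n) (wdRev n n k)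
      = ((q : 𝕜)⁻¹ * (1 - (q : 𝕜) ^ 2)) • tens p (wd n i n ++ wdRev n n k) := by
  obtain ⟨m, hm⟩ : ∃ m, n = m + 1 := ⟨n - 1, by omega⟩
  have hrev : wdRev n n k = idx n n :: wdRev n m k := by
    have := wdRev_succ (n := n) (k := k) (m := m) (by omega)
    rwa [← hm] at this
  rw [hrev]
  induction hin using Nat.decreasingInduction with
  | self =>
    have hx : p (idx n n) (idx n n) = q := hp.last
    have h : skew p ((q : 𝕜) ^ 2) [idx n n] (wdRev n m k)
        = (1 - (q : 𝕜) ^ 2) • tens p (idx n n :: wdRev n m k) := by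
      rcases Nat.lt_or_ge m k with h | h
      · rw [wdRev_eq_nil h, skew_nil_right]
      · obtain ⟨l, rfl⟩ : ∃ l, m = l + 1 := ⟨m - 1, by omega⟩
        have ha : cw p (idx n n) [idx n (l + 1)] = (q ^ 2)⁻¹ := by
          have := hp.cw_adj' (i := l + 1) (by omega) (by omega)
          rwa [← hm] at this
        have hr : (q : 𝕜) ^ 2 * (((q ^ 2)⁻¹ : 𝕜ˣ) : 𝕜) = 1 := by
          have := q.ne_zero
          push_cast
          field_simp
        have h0 : skew p 1 [idx n n] (wdRev n l k) = 0 :=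
          skew_eq_zero_of_orthogonal p _ _ fun x hx y hy => by
            rw [List.mem_singleton.1 hx, cw_comm]
            exact hp.orth_wdRev (by omega) le_rfl hk (by omega) (fun t _ _ => by omega) y hy
        rw [wdRev_succ (by omega), skew_letter_cons, cw_comm, ha, hr, h0]
        simp
    rw [wd_self, skew_letter_cons, hp.cw_last, one_mul, Units.val_pow_eq_pow_val, h, hx, map_smul,
      consL_tens, smul_smul]
    simp
  | of_succ i hin ih =>
    rw [wd_cons hin.le, skew_cons_cons, ih (by omega), ← wd_cons hin.le,
      hp.cw_last_wd (by omega) hin, Units.val_one, mul_one,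
      hp.skew_wd_wdRev hq hk hki (show i ≤ m by omega) (by omega), map_zero, smul_zero, add_zero,
      map_smul, consL_tens, wd_cons (k := i) hin.le, List.cons_append]

/-- With `A = u(k, n)`, `p(A, A) = q`: the factors of adjacent roots cancel against the diagonal. -/
theorem IsTypeB.pw_wd_wd (hp : IsTypeB q p) {k : ℕ} (hk : 1 ≤ k) (hkn : k ≤ n) :
    pw p (wd n k n) (wd n k n) = q := by
  induction hkn using Nat.decreasingInduction with
  | self =>
    have hx : p (idx n n) (idx n n) = q := hp.last
    simp [wd_self, pw, hx]
  | of_succ k hkn ih =>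
    have hx : pw p [idx n k] [idx n k] = q ^ 2 := by
      simpa [pw] using hp.p_self hk hkn
    rw [wd_cons hkn.le, pw_cons_left, pw_cons_right, pw_cons_right p (wd n (k + 1) n), hx,
      ih (by omega), mul_assoc, ← mul_assoc (pw p [idx n k] _), ← cw, hp.cw_wd_succ hk hkn]
    group

end SymmetricWords

/-! ### The image of `u[k, m]` -/

section Coefficients

variable {𝕜 : Type*} [Field 𝕜] {n : ℕ} [NeZero n] {q : 𝕜ˣ} {p : Fin n → Fin n → 𝕜ˣ}

/-- `∏_{k ≤ i < j ≤ m} p_{ij}`. -/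
def triProd (p : Fin n → Fin n → 𝕜ˣ) (k m : ℕ) : 𝕜ˣ :=
  ∏ i ∈ Finset.Icc k m, ∏ j ∈ Finset.Ioc i m, pp p i j

theorem alpha_eq (q : 𝕜ˣ) (p : Fin n → Fin n → 𝕜ˣ) (k m : ℕ) :
    alpha q p k m = (eps n q k m : 𝕜) * ((q : 𝕜) ^ 2 - 1) ^ (m - k) * (triProd p k m : 𝕜) := by
  simp [alpha, triProd]

theorem prod_Icc_pp_left (p : Fin n → Fin n → 𝕜ˣ) (j : ℕ) {k m : ℕ} (h : k ≤ m + 1) :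
    ∏ i ∈ Finset.Icc k m, pp p i j = pw p (wd n k m) [idx n j] := by
  induction m with
  | zero =>
    rcases h.eq_or_lt with rfl | h
    · simp [wd_eq_nil, pw]
    · obtain rfl : k = 0 := by omega
      simp [wd_self, pw, pp]
  | succ m ih =>
    rcases h.eq_or_lt with rfl | h
    · simp [wd_eq_nil, pw]
    · rw [Finset.prod_Icc_succ_top (by omega), ih (by omega), wd_succ (by omega), pw_append_left]
      simp [pw, pp]

theorem prod_Ioc_pp_right (p : Fin n → Fin n → 𝕜ˣ) (k m : ℕ) :
    ∏ j ∈ Finset.Ioc k m, pp p k j = pw p [idx n k] (wd n (k + 1) m) := by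
  rcases Nat.lt_or_ge m k with h | h
  · rw [Finset.Ioc_eq_empty (by omega), wd_eq_nil (by omega)]
    simp [pw]
  induction m, h using Nat.le_induction with
  | base => simp [wd_eq_nil, pw]
  | succ m h ih =>
    rw [Finset.prod_Ioc_succ_top (by omega), ih, wd_succ (by omega), pw_append_right]
    simp [pw, pp]

theorem triProd_self (p : Fin n → Fin n → 𝕜ˣ) (k : ℕ) : triProd p k k = 1 := by simp [triProd]

theorem triProd_succ (p : Fin n → Fin n → 𝕜ˣ) {k m : ℕ} (h : k ≤ m + 1) :
    triProd p k (m + 1) = triProd p k m * pw p (wd n k m) [idx n (m + 1)] := by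
  rw [triProd, Finset.prod_Icc_succ_top h, Finset.Ioc_self, Finset.prod_empty, mul_one, triProd,
    ← prod_Icc_pp_left p _ h, ← Finset.prod_mul_distrib]
  refine Finset.prod_congr rfl fun i hi => ?_
  rw [Finset.prod_Ioc_succ_top (Finset.mem_Icc.1 hi).2]

theorem triProd_cons (p : Fin n → Fin n → 𝕜ˣ) {k m : ℕ} (h : k ≤ m) :
    triProd p k m = pw p [idx n k] (wd n (k + 1) m) * triProd p (k + 1) m := by
  rw [triProd, ← Finset.insert_Icc_add_one_left_eq_Icc h, Finset.prod_insert (by simp), triProd,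
    prod_Ioc_pp_right]

theorem triProd_append (p : Fin n → Fin n → 𝕜ˣ) {k j m : ℕ} (hk : k ≤ j) (hj : j + 1 ≤ m) :
    triProd p k m = triProd p k j * triProd p (j + 1) m * pw p (wd n k j) (wd n (j + 1) m) := by
  induction m, hj using Nat.le_induction with
  | base => rw [triProd_succ p (by omega), triProd_self, wd_self, mul_one]
  | succ m hj ih =>
    rw [triProd_succ p (by omega), ih, triProd_succ p (by omega), wd_succ (k := j + 1) (by omega),
      pw_append_right, wd_append (n := n) (k := k) (j := j) (m := m) (by omega) (by omega),
      pw_append_left]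
    simp only [mul_assoc, mul_comm, mul_left_comm]

theorem alpha_self (q : 𝕜ˣ) (p : Fin n → Fin n → 𝕜ˣ) (k : ℕ) : alpha q p k k = 1 := by
  have h : eps n q k k = 1 := by
    rw [eps, if_neg (by unfold psi; omega), if_neg (by omega)]
  rw [alpha_eq, triProd_self, h]
  simp

theorem alpha_succ (q : 𝕜ˣ) (p : Fin n → Fin n → 𝕜ˣ) {k m : ℕ} (hkm : k ≤ m)
    (hm : m + 1 < psi n k) : alpha q p k (m + 1)
      = alpha q p k m * ((if m = n then (q : 𝕜)⁻¹ else 1) *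
        ((pw p (wdRev n m k) [idx n (m + 1)] : 𝕜) *
        ((q : 𝕜) ^ 2 - 1))) := by
  have he : (eps n q k (m + 1) : 𝕜) = (eps n q k m : 𝕜) * (if m = n then (q : 𝕜)⁻¹ else 1) := by
    unfold psi at hm
    have h1 : m + 1 ≠ psi n k := by unfold psi; omega
    have h2 : m ≠ psi n k := by unfold psi; omega
    rw [eps, eps, if_neg h1, if_neg h2]
    rcases lt_trichotomy m n with h | h | h
    · rw [if_neg (by omega), if_neg (by omega), if_neg (by omega)]; simp
    · rw [if_pos (by omega), if_neg (by omega), if_pos h]; simp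
    · rw [if_pos (by omega), if_pos (by omega), if_neg (by omega)]; simp
  rw [alpha_eq, alpha_eq, triProd_succ p (by omega), he, Nat.succ_sub hkm, pow_succ,
    pw_perm p (wdRev_perm k m) (List.Perm.refl _)]
  push_cast
  ring

theorem alpha_cons (q : 𝕜ˣ) (p : Fin n → Fin n → 𝕜ˣ) {k m : ℕ} (hkm : k < m) (hm : psi n k < m) :
    alpha q p k m = alpha q p (k + 1) m * ((if k = n then (q : 𝕜)⁻¹ else 1) * ((q : 𝕜) ^ 2 - 1) *
      (pw p [idx n k] (wdRev n m (k + 1)) : 𝕜)) := by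
  have he : (eps n q k m : 𝕜) = (eps n q (k + 1) m : 𝕜) * (if k = n then (q : 𝕜)⁻¹ else 1) := by
    unfold psi at hm
    have h1 : m ≠ psi n k := by unfold psi; omega
    have h2 : m ≠ psi n (k + 1) := by unfold psi; omega
    rw [eps, eps, if_neg h1, if_neg h2]
    rcases lt_trichotomy k n with h | h | h
    · rw [if_pos (by omega), if_pos (by omega), if_neg (by omega)]; simp
    · rw [if_pos (by omega), if_neg (by omega), if_pos h]; simp
    · rw [if_neg (by omega), if_neg (by omega), if_neg (by omega)]; simp
  rw [alpha_eq, alpha_eq, triProd_cons p hkm.le, he, show m - k = m - (k + 1) + 1 by omega,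
    pow_succ, pw_perm p (List.Perm.refl _) (wdRev_perm (k + 1) m)]
  push_cast
  ring

theorem IsTypeB.shHom_leftBr (hp : IsTypeB q p) {k d : ℕ} (hk : 1 ≤ k) (h : k + d < psi n k) :
    shHom p (leftBr p k d) = alpha q p k (k + d) • tens p (wdRev n (k + d) k) := by
  induction d with
  | zero => rw [leftBr, add_zero, alpha_self, wdRev_self, shHom_xv]
  | succ d ih =>
    rw [leftBr, shHom_br p (isHomog_leftBr p k d) (isHomog_xv _) (wdRev_perm _ _)
      (List.Perm.refl _) (ih (by omega)) (shHom_xv p _), ← add_assoc,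
      hp.skew_wdRev_letter hk (by omega) (by omega), smul_smul, mul_one,
      alpha_succ q p (by omega) (by omega)]

theorem IsTypeB.shHom_rightBr (hp : IsTypeB q p) {k d : ℕ} (hk : 1 ≤ k) (hd : k + d ≤ 2 * n)
    (h : psi n k < k + d) :
    shHom p (rightBr p k d) = alpha q p k (k + d) • tens p (wdRev n (k + d) k) := by
  induction d generalizing k with
  | zero => rw [rightBr, add_zero, alpha_self, wdRev_self, shHom_xv]
  | succ d ih =>
    have hs : k + (d + 1) = k + 1 + d := by omega
    have h1 : psi n (k + 1) < k + 1 + d := by unfold psi at h ⊢; omega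
    rw [hs] at h hd
    rw [rightBr, shHom_br p (isHomog_xv _) (isHomog_rightBr p (k + 1) d) (List.Perm.refl _)
      (wdRev_perm _ _) (shHom_xv p _) (ih (by omega) hd h1), hs,
      hp.skew_letter_wdRev hk (by omega) hd h, smul_smul, one_mul, alpha_cons q p (by omega) h]

/-- The image of the bracketed word `u[k, m]` in the shuffle algebra. -/
theorem IsTypeB.shHom_uBr (hp : IsTypeB q p) (hq : (q : 𝕜) ^ 2 - 1 ≠ 0) {k m : ℕ} (hk : 1 ≤ k)
    (hkm : k ≤ m) (hm : m ≤ 2 * n) :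
    shHom p (uBr p k m) = alpha q p k m • tens p (wdRev n m k) := by
  rw [uBr]
  split_ifs with h1 h2
  · have := hp.shHom_leftBr (d := m - k) hk (by omega)
    rwa [Nat.add_sub_cancel' hkm] at this
  · have := hp.shHom_rightBr (d := m - k) hk (by omega) (by omega)
    rwa [Nat.add_sub_cancel' hkm] at this
  · obtain rfl : m = psi n k := by omega
    have hkn : k ≤ n := by unfold psi at hkm; omega
    have hle : n + 1 ≤ psi n k := by unfold psi; omega
    have hr := hp.shHom_rightBr (k := n + 1) (d := psi n k - (n + 1)) (by omega) (by omega)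
      (by unfold psi; omega)
    have hl := hp.shHom_leftBr (k := k) (d := n - k) hk (by omega)
    have h3 := isHomog_rightBr p (n + 1) (psi n k - (n + 1))
    have h4 := isHomog_leftBr p k (n - k)
    rw [Nat.add_sub_cancel' hle] at hr h3
    rw [Nat.add_sub_cancel' hkn] at hl h4
    have hperm : (wd n (n + 1) (psi n k)).Perm (wd n k n) :=
      (wdRev_perm _ _).trans (by rw [wdRev_psi hk hkn])
    rw [map_smul, shHom_br p h3 h4 (wdRev_perm _ _) (wdRev_perm _ _) hr hl, wdRev_psi hk hkn,
      hp.skew_wd_wdRev_last hq hk le_rfl hkn, smul_smul, smul_smul,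
      wdRev_append (n := n) (k := k) (j := n) (m := psi n k) (by omega) (by omega),
      wdRev_psi hk hkn, pw_perm p hperm (List.Perm.refl _), hp.pw_wd_wd hk hkn]
    congr 1
    have e1 : eps n q (n + 1) (psi n k) = 1 := by
      rw [eps, if_neg (by unfold psi; omega), if_neg (by omega)]
    have e2 : eps n q k n = 1 := by
      rw [eps, if_neg (by unfold psi; omega), if_neg (by omega)]
    have e3 : eps n q k (psi n k) = (q ^ 3)⁻¹ := by rw [eps, if_pos rfl]
    rw [alpha_eq, alpha_eq, alpha_eq, e1, e2, e3, triProd_append p hkn hle,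
      pw_perm p (List.Perm.refl (wd n k n)) hperm, hp.pw_wd_wd hk hkn,
      show psi n k - k = (psi n k - (n + 1)) + (n - k) + 1 by unfold psi; omega, pow_succ, pow_add]
    have := q.ne_zero
    push_cast
    field_simp
    ring

end Coefficients

/-! ### The Serre relations -/

section SerreRelations

variable {𝕜 : Type*} [Field 𝕜] {n : ℕ} [NeZero n] {q : 𝕜ˣ} {p : Fin n → Fin n → 𝕜ˣ}

/-- The relation `[x, [x, y]] = 0` in the shuffle algebra, for adjacent letters. -/
theorem skew_letter_adjacent_self {ι : Type*} {p : ι → ι → 𝕜ˣ} {x y : ι} (hx : p x x = q ^ 2)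
    (hy : cw p x [y] = (q ^ 2)⁻¹) : skew p 1 [x] [y, x] = 0 := by
  have hc : cw p x [x] = q ^ 4 := by
    rw [cw_singleton, hx]
    group
  have hr : (1 : 𝕜) * (((q ^ 2)⁻¹ : 𝕜ˣ) : 𝕜) = ((q : 𝕜) ^ 2)⁻¹ := by push_cast; rw [one_mul]
  rw [skew_letter_cons, cw_comm, hy, hr, skew_letter_cons, hc, hx, skew_nil_right, map_smul,
    consL_tens, smul_smul, ← add_smul, map_smul, smul_smul]
  simp only [sub_self, zero_smul, zero_add]
  convert zero_smul 𝕜 _ using 2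
  have := q.ne_zero
  push_cast
  field_simp
  ring

/-- The defining relations of `U_q⁺(so_{2n+1})` hold in the shuffle algebra. -/
theorem IsTypeB.shHom_serreRel (hp : IsTypeB q p) {f : FreeAlgebra 𝕜 (Fin n)} (hf : SerreRel p f) :
    shHom p f = 0 := by
  have hbr : ∀ i, 1 ≤ i → i < n → shHom p (br p (xv 𝕜 n i) (xv 𝕜 n (i + 1)))
      = (((pw p [idx n i] [idx n (i + 1)] : 𝕜) * ((q : 𝕜) ^ 2 - 1))) •
        tens p [idx n (i + 1), idx n i] := by
    intro i h1 h2
    rw [shHom_br p (isHomog_xv _) (isHomog_xv _) (List.Perm.refl _) (List.Perm.refl _)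
      (shHom_xv p _) (shHom_xv p _), skew_adjacent_cons' (hp.cw_adj' h1 h2) (by simp), smul_smul,
      one_mul, one_mul]
  have hh : ∀ i, IsHomog [idx n i, idx n (i + 1)] (br p (xv 𝕜 n i) (xv 𝕜 n (i + 1))) :=
    fun i => (isHomog_xv i).br p (isHomog_xv (i + 1))
  cases hf with
  | left i h1 h2 =>
    rw [shHom_br p (isHomog_xv i) (hh i) (List.Perm.refl _) (List.Perm.swap _ _ _) (shHom_xv p i)
      (hbr i h1 h2), skew_letter_adjacent_self (hp.p_self h1 h2) (hp.cw_adj h1 h2), smul_zero]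
  | far i j h1 h2 h3 =>
    rw [shHom_br p (isHomog_xv i) (isHomog_xv j) (List.Perm.refl _) (List.Perm.refl _)
      (shHom_xv p i) (shHom_xv p j), skew_eq_zero_of_orthogonal p _ _ fun x hx y hy => by
        rw [List.mem_singleton.1 hx, List.mem_singleton.1 hy, cw_comm, cw_singleton]
        exact hp.far i j h1 h2 h3, smul_zero]
  | right i h1 h2 =>
    rw [shHom_br p (hh i) (isHomog_xv (i + 1)) (List.Perm.swap _ _ _) (List.Perm.refl _)
      (hbr i h1 (by omega)) (shHom_xv p (i + 1)), skew_self_adjacent_cons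
        (hp.p_self (by omega) h2) (hp.cw_adj' h1 (by omega)) (by simp), smul_zero]
  | last h =>
    -- `x_n` is a short root: `p_{nn} = q`, and the chain of brackets with it is longer by one.
    obtain ⟨i, hi⟩ : ∃ i, n = i + 1 := ⟨n - 1, by omega⟩
    have hq := q.ne_zero
    have e1 : n - 1 = i := by omega
    have hb := hbr i (by omega) (by omega)
    have hhi := hh i
    have ha : cw p (idx n n) [idx n i] = (q ^ 2)⁻¹ := by
      have := hp.cw_adj' (i := i) (by omega) (by omega)
      rwa [← hi] at this
    have hx : p (idx n n) (idx n n) = q := hp.last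
    rw [← hi] at hb hhi
    rw [e1]
    have s1 : skew p 1 [idx n n, idx n i] [idx n n]
        = ((((pw p [idx n n] [idx n i])⁻¹ : 𝕜ˣ) : 𝕜) * (1 - ((q : 𝕜) ^ 2)⁻¹)) •
          tens p [idx n n, idx n n, idx n i] := by
      rw [skew_cons_letter, skew_adjacent_cons ha (by simp), map_smul, consL_tens, cw_cons, ha,
        hp.cw_last, mul_inv_cancel]
      simp
    have s2 : skew p 1 [idx n n, idx n n, idx n i] [idx n n] = 0 := by
      rw [skew_cons_letter, s1, map_smul, consL_tens, ← add_smul, cw_cons,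
        cw_cons p _ (idx n n) [_], ha, hp.cw_last, pw_cons p _ (idx n n) [_, _],
        pw_cons p _ (idx n n) [_], hx]
      convert zero_smul 𝕜 _ using 2
      push_cast
      field_simp
      ring
    have h2 := shHom_br p hhi (isHomog_xv (𝕜 := 𝕜) n) (List.Perm.swap _ _ _) (List.Perm.refl _) hb
      (shHom_xv p n)
    rw [s1, smul_smul] at h2
    rw [shHom_br p (hhi.br p (isHomog_xv n)) (isHomog_xv n) (u' := [idx n n, idx n n, idx n i])
      ((List.perm_append_comm (l₁ := [idx n i, idx n n]) (l₂ := [idx n n])).trans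
        (List.Perm.cons _ (List.Perm.swap _ _ _))) (List.Perm.refl _) h2 (shHom_xv p n), s2,
      smul_zero]

theorem IsTypeB.shAct_eq_zero_of_mem_serreIdeal (hp : IsTypeB q p) {a : GX p}
    (ha : a ∈ serreIdeal p) : shAct p a 1 = 0 := by
  rw [serreIdeal, TwoSidedIdeal.mem_asIdeal] at ha
  have h : TwoSidedIdeal.span (freeOf p '' {f | SerreRel p f})
      ≤ TwoSidedIdeal.ker (shAct p) := by
    rw [TwoSidedIdeal.span_le]
    rintro _ ⟨f, hf, rfl⟩
    rw [SetLike.mem_coe, TwoSidedIdeal.mem_ker]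
    refine LinearMap.ext fun w => ?_
    rw [shAct_freeOf, hp.shHom_serreRel hf, zero_mul, LinearMap.zero_apply]
  rw [(TwoSidedIdeal.mem_ker _).1 (h ha), LinearMap.zero_apply]

end SerreRelations

end QBorel

theorem mainTheorem10 {𝕜 : Type*} [Field 𝕜] (n : ℕ) [NeZero n] (q : 𝕜ˣ)
    (p : Fin n → Fin n → 𝕜ˣ) (hp : QBorel.IsTypeB q p) (hq3 : q ^ 3 ≠ 1) (hq4 : q ^ 4 ≠ 1) :
    ((∃! ρ : QBorel.posPart (QBorel.serreIdeal p) →ₐ[𝕜] QBorel.Sh p, QBorel.IsShuffleRep _ ρ) ∧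
      ∀ ρ : QBorel.posPart (QBorel.serreIdeal p) →ₐ[𝕜] QBorel.Sh p, QBorel.IsShuffleRep _ ρ →
        ∀ k m : ℕ, 1 ≤ k → k ≤ m → m ≤ 2 * n →
          ρ (QBorel.posVal _ (QBorel.uBr p k m))
            = QBorel.alpha q p k m • QBorel.tens p (QBorel.wdRev n m k)) ∧
    ((∃! ρ : QBorel.posPart (QBorel.lam p) →ₐ[𝕜] QBorel.Sh p, QBorel.IsShuffleRep _ ρ) ∧
      ∀ ρ : QBorel.posPart (QBorel.lam p) →ₐ[𝕜] QBorel.Sh p, QBorel.IsShuffleRep _ ρ →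
        ∀ k m : ℕ, 1 ≤ k → k ≤ m → m ≤ 2 * n →
          ρ (QBorel.posVal _ (QBorel.uBr p k m))
            = QBorel.alpha q p k m • QBorel.tens p (QBorel.wdRev n m k)) := by
  have hq : (q : 𝕜) ^ 2 - 1 ≠ 0 := by
    intro h
    refine hq4 (Units.ext ?_)
    push_cast
    linear_combination ((q : 𝕜) ^ 2 + 1) * h
  refine ⟨⟨QBorel.existsUnique_isShuffleRep _ fun a ha => hp.shAct_eq_zero_of_mem_serreIdeal ha,
    fun ρ hρ k m hk hkm hm => ?_⟩, QBorel.existsUnique_isShuffleRep _ fun a ha =>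
      QBorel.shAct_eq_zero_of_mem_lam p ha, fun ρ hρ k m hk hkm hm => ?_⟩
  · rw [hρ.apply_posVal, hp.shHom_uBr hq hk hkm hm]
  · rw [hρ.apply_posVal, hp.shHom_uBr hq hk hkm hm]
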